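/- Let $N,L\ge 1$ be integers, let $\Gamma>0$ be real, and let $M_1<M_2<\dots<M_L$ be pairwise coprime positive integers; put $m_l=\Gamma M_l$ and $P=\prod_{l=1}^{\lceil L/N\rceil}M_l$. For real $x$ and $m>0$ write $\langle x\rangle_m=x-m\lfloor x/m\rfloor\in[0,m)$. Unknown reals $X=(X_1,\dots,X_N)\in[0,\Gamma(P-1))^N$ are observed only through the $L$ unordered families (with multiplicity) $\mathcal R_l=\{\langle X_i+\Delta_{il}\rangle_{m_l}: i=1,\dots,N\}$, $l=1,\dots,L$, with unknown real errors satisfying $\max_{i,l}|\Delta_{il}|<\Gamma/4$. A hypothesis consists of a clustering, i.e. a distribution of the observed residues into $N$ clusters $S_i=\{r_{(il)}: l=1,\dots,L\}$, each containing exactly one residue from each $\mathcal R_l$ (every observed residue being used exactly once), together with binary shifts $\tau_{(il)}\in\{0,1\}$. Its shifted common residues are $\hat r^c_{(il)}=\langle r_{(il)}\rangle_\Gamma-\tau_{(il)}\Gamma$. The hypothesis is accepted, with folding numbers $q_1,\dots,q_N\in\mathbb Z$, if $q_i\equiv (r_{(il)}-\hat r^c_{(il)})/\Gamma \pmod{M_l}$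 for all $i,l$, and the following two criteria hold: (1) $|\hat r^c_{(il)}-\hat r^c_{(il')}|<\Gamma/2$ for all $i,l,l'$; (2) $0\le q_i<P$ for all $i$. The estimates of an accepted hypothesis are $\hat X_i=q_i\Gamma+\frac1L\sum_{l=1}^L\hat r^c_{(il)}$. Then there is a decoder, depending only on $N,L,\Gamma,M_1,\dots,M_L$, which for all such $X$ and all such errors computes from $(\mathcal R_1,\dots,\mathcal R_L)$ alone the estimates $\hat X=(\hat X_1,\dots,\hat X_N)$ of some accepted hypothesis (in particular an accepted hypothesis exists), such that, after a suitable renumbering of the estimates, $|\hat X_i-X_i|<\frac{3\Gamma}{4}$ for every $i=1,\dots,N$. -/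

import Mathlib

/-- The real remainder `⟨x⟩_m = x - m ⌊x / m⌋`, an element of `[0, m)` for `m > 0`. -/
noncomputable def realMod (x m : ℝ) : ℝ := x - m * (⌊x / m⌋ : ℝ)

/-- The product of the `⌈L / N⌉` first (smallest, if `M` is increasing) of the integers
`M 0 < M 1 < … < M (L - 1)`. -/
noncomputable def headProd (N : ℕ) {L : ℕ} (M : Fin L → ℕ) : ℕ :=
  ∏ l ∈ Finset.univ.filter (fun l : Fin L => (l : ℕ) < ⌈(L : ℝ) / (N : ℝ)⌉₊), M l

/-- The noisy observation: for every modulus `Γ * M l`, the unordered family (multiset) of the `N`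
residues `⟨X i + Δ i l⟩` modulo `Γ * M l`. Which residue belongs to which `X i` is not recorded. -/
noncomputable def noisyResidues {N L : ℕ} (Γ : ℝ) (M : Fin L → ℕ) (X : Fin N → ℝ)
    (Δ : Fin N → Fin L → ℝ) : Fin L → Multiset ℝ :=
  fun l => (Finset.univ : Finset (Fin N)).val.map (fun i => realMod (X i + Δ i l) (Γ * (M l : ℝ)))

/-- A decoding hypothesis: `cluster i l` is the residue modulo `Γ * M l` put into the `i`-th
cluster, and `shift i l` is the binary shift attached to it. -/
structure Hypothesis (N L : ℕ) where
  cluster : Fin N → Fin L → ℝ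
  shift : Fin N → Fin L → Fin 2

/-- The shifted common residue `⟨r⟩_Γ - τ Γ` of a clustered residue `r` with shift `τ`. -/
noncomputable def Hypothesis.commonResidue {N L : ℕ} (h : Hypothesis N L) (Γ : ℝ)
    (i : Fin N) (l : Fin L) : ℝ :=
  realMod (h.cluster i l) Γ - (((h.shift i l : Fin 2) : ℕ) : ℝ) * Γ

/-- The hypothesis `h`, with recovered folding numbers `q`, passes the test on the observed
unordered residues `R`. -/
structure Hypothesis.Accepted {N L : ℕ} (h : Hypothesis N L) (Γ : ℝ) (M : Fin L → ℕ)
    (R : Fin L → Multiset ℝ) (q : Fin N → ℕ) : Prop where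
  /-- The clusters distribute the observed residues: each cluster gets exactly one residue of each
  modulus, and every observed residue is used exactly once. -/
  isClustering : ∀ l, (Finset.univ : Finset (Fin N)).val.map (fun i => h.cluster i l) = R l
  /-- `q i ≡ (r - r̂) / Γ` modulo `M l`, for the residue `r` of cluster `i` modulo `Γ * M l` and its
  shifted common residue `r̂` (the quotient is an integer). -/
  folding : ∀ i l, ∃ a : ℤ,
    h.cluster i l - h.commonResidue Γ i l = (a : ℝ) * Γ ∧ (q i : ℤ) ≡ a [ZMOD (M l : ℤ)]
  /-- First criterion: within a cluster, shifted common residues differ by less than `Γ / 2`. -/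
  criterion_one : ∀ i l l', |h.commonResidue Γ i l - h.commonResidue Γ i l'| < Γ / 2
  /-- Second criterion: the folding numbers lie in their dynamic range. -/
  criterion_two : ∀ i, q i < headProd N M

/-- The estimate `q i * Γ` plus the average of the shifted common residues of the `i`-th cluster. -/
noncomputable def Hypothesis.estimate {N L : ℕ} (h : Hypothesis N L) (Γ : ℝ) (q : Fin N → ℕ)
    (i : Fin N) : ℝ :=
  (q i : ℝ) * Γ + (∑ l, h.commonResidue Γ i l) / (L : ℝ)

/-!
The decoder picks any admissible pair of unknowns and errors that explains the observation, and
returns the averages of its noisy readings. These are the estimates of an accepted hypothesis, the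
one which clusters and shifts the readings correctly for the chosen unknowns `Y`
(`correctHypothesis_accepted`, `correctHypothesis_estimate`), and they are within `Γ / 4` of `Y`. So
it remains to show that two admissible explanations `X`, `Y` of one observation agree up to order
within `Γ / 2` (`exists_perm_abs_sub_le`).

In units of `Γ`, equality of the residue families says that for each `l` the families `x` and `y`
can be matched on the circle of length `M l` with distances below `1 / 2`; one has to match them on
the line. The distances in the finitely many circle matchings are bounded away from `1 / 2`, so the
positions can be rounded to a fine grid, and `y` moved by half a unit; then each `y` has to follow
its partner within one unit, a *turn* of `Q` grid steps, and all positions may be assumed distinct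
modulo `Q` (`genericConfig_of_real`). On the line, matching in increasing order works iff
`headSurplus ≥ 0` and `tailSurplus ≤ 0` (`exists_line_match`), and by symmetry it is enough to prove
the former (`tailSurplus_nonpos`).

Suppose that the window `[s, t)` contains more of the `a i` than `[s, t + Q)` contains of the `b j`.
Hall's inequality for the circle of length `M l` (`CircleMatch.exists_pos`) then gives a translate
by a nonzero multiple of `M l` turns with a positive surplus. A nonzero integer below `P`, the
product of the `g + 1 = ⌈L / N⌉` smallest moduli, is divisible by at most `g` moduli, while
`L > g N`; hence more than `N` units of positive surplus would be needed, unless one of the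
translates is by `P` turns. The total surplus over all translates is the number `N` plus the
difference of the values at `t` and at `s` of a periodic function, `winding`. Starting at a class
`s` where `winding` is maximal and taking the shortest deficient window, this total is at most
`N - 1`, so that the translate by `P` turns must occur and everything else is tight
(`saturated_of_cover`).

This exceptional case is a boundary effect, since all positions lie in `[0, P - 1 / 2)`. It pins
the shortest deficient windows near both ends of the line (`exists_upper_base`,
`exists_lower_base`), and together they force `headSurplus` to be `-1` on a whole turn
(`exists_flat_turn`). That turn contains a class where `winding` is minimal, and the shortest
deficient window ending in that class has no translate by `P` turns with positive surplus, which
contradicts the count (`headSurplus_nonneg`).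
-/

/-! ### Counting moduli dividing an integer -/

/-- The moduli that divide `m`. -/
def modDivisors {L : ℕ} (M : Fin L → ℕ) (m : ℤ) : Finset (Fin L) :=
  Finset.univ.filter fun l => (M l : ℤ) ∣ m

lemma mem_modDivisors {L : ℕ} {M : Fin L → ℕ} {m : ℤ} {l : Fin L} :
    l ∈ modDivisors M m ↔ (M l : ℤ) ∣ m := by simp [modDivisors]

/-- Pairwise coprime moduli dividing `m ≠ 0` have product at most `|m|`. -/
lemma prod_le_natAbs_of_dvd {L : ℕ} {M : Fin L → ℕ}
    (hco : ∀ l l', l ≠ l' → Nat.Coprime (M l) (M l')) {m : ℤ} (hm : m ≠ 0)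
    (S : Finset (Fin L)) (hS : ∀ l ∈ S, (M l : ℤ) ∣ m) : ∏ l ∈ S, M l ≤ m.natAbs := by
  apply Nat.le_of_dvd (Int.natAbs_pos.mpr hm)
  rw [← Int.natCast_dvd, Nat.cast_prod]
  apply Finset.prod_dvd_of_coprime
  · intro l _ l' _ hne
    exact Nat.isCoprime_iff_coprime.mpr (hco l l' hne)
  · exact hS

lemma filter_lt_card_le {L : ℕ} (n : ℕ) :
    (Finset.univ.filter fun l : Fin L => (l : ℕ) < n).card ≤ n := by
  have : (Finset.univ.filter fun l : Fin L => (l : ℕ) < n).card ≤ (Finset.range n).card := by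
    apply Finset.card_le_card_of_injOn (fun l : Fin L => (l : ℕ))
    · intro l hl
      simpa using hl
    · intro x _ y _ h
      exact Fin.ext h
  simpa using this

/-- Among the sets of at least `n` indices, the initial one has the least product of moduli. -/
lemma prod_initial_le {L : ℕ} {M : Fin L → ℕ} (hpos : ∀ l, 0 < M l) (hmono : StrictMono M)
    (n : ℕ) (S : Finset (Fin L)) (hS : n ≤ S.card) :
    ∏ l ∈ Finset.univ.filter (fun l : Fin L => (l : ℕ) < n), M l ≤ ∏ l ∈ S, M l := by
  set A := Finset.univ.filter (fun l : Fin L => (l : ℕ) < n) with hA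
  have hAcard : A.card ≤ n := filter_lt_card_le n
  -- exchange `A \ S` for `S \ A`: every modulus of the former is smaller
  have hcard : (A \ S).card ≤ (S \ A).card := by
    have h1 := Finset.card_sdiff_add_card_inter A S
    have h2 := Finset.card_sdiff_add_card_inter S A
    rw [Finset.inter_comm] at h2
    omega
  obtain ⟨T, hTS, hT⟩ := Finset.exists_subset_card_eq hcard
  have e : ↥(A \ S) ≃ ↥T := Finset.equivOfCardEq hT.symm
  have hle : ∏ l ∈ A \ S, M l ≤ ∏ l ∈ T, M l := by
    rw [← Finset.prod_coe_sort (A \ S), ← Finset.prod_coe_sort T, ← Equiv.prod_comp e]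
    apply Finset.prod_le_prod'
    intro x _
    apply hmono.monotone
    have hx : (x : Fin L) ∈ A := (Finset.mem_sdiff.mp x.2).1
    have hy : ((e x : Fin L)) ∉ A := (Finset.mem_sdiff.mp (hTS (e x).2)).2
    simp only [hA, Finset.mem_filter, Finset.mem_univ, true_and] at hx hy
    show ((x : Fin L) : ℕ) ≤ ((e x : Fin L) : ℕ)
    omega
  have hle2 : ∏ l ∈ T, M l ≤ ∏ l ∈ S \ A, M l :=
    Finset.prod_le_prod_of_subset_of_one_le' hTS fun i _ _ => hpos i
  calc ∏ l ∈ A, M l = (∏ l ∈ A ∩ S, M l) * ∏ l ∈ A \ S, M l :=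
        (Finset.prod_inter_mul_prod_sdiff A S _).symm
    _ ≤ (∏ l ∈ A ∩ S, M l) * ∏ l ∈ S \ A, M l :=
        Nat.mul_le_mul_left _ (hle.trans hle2)
    _ = ∏ l ∈ S, M l := by
        rw [Finset.inter_comm]; exact Finset.prod_inter_mul_prod_sdiff S A _

/-- The data on the moduli that the matching argument uses. A nonzero integer of absolute value
below `P` is divisible by at most `g` moduli; `P` itself is divisible by at most `g + 1`, one of
which is the smallest modulus `M l₀`; and there are more than `g * N` moduli. -/
structure ModuliData {L : ℕ} (N g P : ℕ) (M : Fin L → ℕ) (l₀ : Fin L) : Prop where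
  pos : ∀ l, 0 < M l
  one_le : 1 ≤ g
  card : g * N + 1 ≤ L
  card_divisors_le : ∀ m : ℤ, m ≠ 0 → |m| < P → (modDivisors M m).card ≤ g
  card_divisors_top : (modDivisors M (P : ℤ)).card ≤ g + 1
  least_dvd : M l₀ ∣ P
  least_lt_top : M l₀ < P
  least_lt : ∀ l, l ≠ l₀ → M l₀ < M l

/-- A function on `ℤ` whose only negative value is `-1` at `0`, whose total is less than `N`, and
which is positive at a nonzero multiple of every modulus, must be positive at the exceptional point
`e = ±P`; and then the bound `g * N` on the number of moduli is attained so tightly that all the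
positive values are `1`, and that no other one sits at a multiple of the smallest modulus `M l₀` or
within `M l₀` of the origin. -/
lemma saturated_of_cover {L N g P : ℕ} {M : Fin L → ℕ} {l₀ : Fin L}
    (D : ModuliData N g P M l₀) {F : ℤ → ℤ} (hF0 : F 0 = -1)
    (hFnn : ∀ m, m ≠ 0 → 0 ≤ F m) {K : ℕ}
    (hsupp : ∀ m, F m ≠ 0 → m ∈ Finset.Icc (-(K : ℤ)) K)
    (hsum : ∑ m ∈ Finset.Icc (-(K : ℤ)) K, F m ≤ (N : ℤ) - 1)
    (hcover : ∀ l, ∃ m, m ≠ 0 ∧ (M l : ℤ) ∣ m ∧ 0 < F m)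
    {e : ℤ} (he : e = P ∨ e = -P) (hrange : ∀ m, 0 < F m → |m| < P ∨ m = e) :
    0 < F e ∧ (∀ m, F m ≤ 1) ∧ ∑ m ∈ Finset.Icc (-(K : ℤ)) K, F m = (N : ℤ) - 1 ∧
      ∀ m, m ≠ e → 0 < F m → ¬ (M l₀ : ℤ) ∣ m ∧ (M l₀ : ℤ) < |m| := by
  classical
  set I := Finset.Icc (-(K : ℤ)) K with hI
  set T := I.filter (fun m => 0 < F m) with hT
  have memT : ∀ m, m ∈ T ↔ 0 < F m := by
    intro m
    simp only [hT, Finset.mem_filter]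
    exact ⟨fun h => h.2, fun h => ⟨hsupp m (by omega), h⟩⟩
  have ne0 : ∀ m ∈ T, m ≠ 0 := by
    rintro m hm rfl
    rw [memT] at hm; omega
  have h0I : (0 : ℤ) ∈ I := by simp [hI]
  have sumT : ∑ m ∈ T, F m = ∑ m ∈ I, F m + 1 := by
    have h1 : ∑ m ∈ I, F m = ∑ m ∈ T, F m + ∑ m ∈ I.filter (fun m => ¬ 0 < F m), F m :=
      (Finset.sum_filter_add_sum_filter_not I _ _).symm
    have h2 : ∑ m ∈ I.filter (fun m => ¬ 0 < F m), F m = F 0 := by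
      apply Finset.sum_eq_single_of_mem
      · simp [h0I, hF0]
      · intro m hm hm0
        have := hFnn m hm0
        have := (Finset.mem_filter.mp hm).2
        omega
    omega
  have cardT : (T.card : ℤ) ≤ ∑ m ∈ T, F m := by
    rw [Finset.card_eq_sum_ones, Nat.cast_sum]
    apply Finset.sum_le_sum
    intro m hm
    have := (memT m).1 hm
    push_cast; omega
  have hcov : ∀ l : Fin L, ∃ m ∈ T, l ∈ modDivisors M m := by
    intro l
    obtain ⟨m, _, h2, h3⟩ := hcover l
    exact ⟨m, (memT m).2 h3, mem_modDivisors.2 h2⟩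
  have deg : ∀ m ∈ T, m ≠ e → (modDivisors M m).card ≤ g := by
    intro m hm hme
    rcases hrange m ((memT m).1 hm) with h | h
    · exact D.card_divisors_le m (ne0 m hm) h
    · exact absurd h hme
  have dege : (modDivisors M e).card ≤ g + 1 := by
    rcases he with rfl | rfl
    · exact D.card_divisors_top
    · have : modDivisors M (-(P : ℤ)) = modDivisors M P := by
        ext l; simp [mem_modDivisors]
      rw [this]; exact D.card_divisors_top
  have l0e : l₀ ∈ modDivisors M e := by
    rw [mem_modDivisors]
    have := Int.natCast_dvd_natCast.mpr D.least_dvd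
    rcases he with rfl | rfl
    · exact this
    · exact (dvd_neg).2 this
  have hTN : T.card ≤ N := by
    have : (T.card : ℤ) ≤ N := by omega
    exact_mod_cast this
  have heT : e ∈ T := by
    by_contra hne
    have hu : (Finset.univ : Finset (Fin L)) ⊆ T.biUnion (modDivisors M) := by
      intro l _
      obtain ⟨m, hm, hl⟩ := hcov l
      exact Finset.mem_biUnion.2 ⟨m, hm, hl⟩
    have h1 := Finset.card_le_card hu
    have h2 := Finset.card_biUnion_le_card_mul T (modDivisors M) g
      (fun m hm => deg m hm (fun h => hne (h ▸ hm)))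
    rw [Finset.card_univ, Fintype.card_fin] at h1
    have h3 := Nat.mul_le_mul_right g hTN
    have := D.card
    rw [mul_comm] at this
    omega
  have hTeq : T.card = N := by
    have hu : (Finset.univ : Finset (Fin L)) ⊆
        modDivisors M e ∪ (T.erase e).biUnion (modDivisors M) := by
      intro l _
      obtain ⟨m, hm, hl⟩ := hcov l
      by_cases h : m = e
      · exact Finset.mem_union_left _ (h ▸ hl)
      · exact Finset.mem_union_right _
          (Finset.mem_biUnion.2 ⟨m, Finset.mem_erase.2 ⟨h, hm⟩, hl⟩)
    have h1 := (Finset.card_le_card hu).trans (Finset.card_union_le _ _)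
    have h2 := Finset.card_biUnion_le_card_mul (T.erase e) (modDivisors M) g
      (fun m hm => deg m (Finset.mem_of_mem_erase hm) (Finset.ne_of_mem_erase hm))
    rw [Finset.card_univ, Fintype.card_fin] at h1
    rw [Finset.card_erase_of_mem heT] at h2
    have hTpos : 0 < T.card := Finset.card_pos.2 ⟨e, heT⟩
    have := D.card
    have := D.one_le
    by_contra hne
    have hlt : T.card + 1 ≤ N := by omega
    obtain ⟨r, hr⟩ : ∃ r, T.card = r + 1 := ⟨T.card - 1, by omega⟩
    rw [hr] at h2 hlt
    have h3 := Nat.mul_le_mul_left g hlt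
    simp only [Nat.add_sub_cancel] at h2
    nlinarith
  have sumN : ∑ m ∈ T, F m = N := by
    have : (T.card : ℤ) = N := by exact_mod_cast hTeq
    omega
  refine ⟨(memT e).1 heT, ?_, by omega, ?_⟩
  · intro m
    by_contra hm
    have hmT : m ∈ T := (memT m).2 (by omega)
    have : ∑ m ∈ T, (1 : ℤ) < ∑ m ∈ T, F m :=
      Finset.sum_lt_sum (fun x hx => by have := (memT x).1 hx; omega) ⟨m, hmT, by omega⟩
    simp only [Finset.sum_const, nsmul_eq_mul, mul_one] at this
    have : (T.card : ℤ) = N := by exact_mod_cast hTeq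
    omega
  · intro m hme hm
    have hmT : m ∈ T := (memT m).2 hm
    -- otherwise `m` contributes at most `g - 1` moduli that do not divide `e`
    have key : g ≤ ((modDivisors M m).erase l₀).card := by
      have hmT' : m ∈ T.erase e := Finset.mem_erase.2 ⟨hme, hmT⟩
      have hu : (Finset.univ : Finset (Fin L)) ⊆
          modDivisors M e ∪ ((modDivisors M m).erase l₀ ∪
            ((T.erase e).erase m).biUnion (modDivisors M)) := by
        intro l _
        obtain ⟨x, hx, hl⟩ := hcov l
        by_cases h : x = e
        · exact Finset.mem_union_left _ (h ▸ hl)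
        by_cases h' : x = m
        · by_cases hl0 : l = l₀
          · exact Finset.mem_union_left _ (hl0 ▸ l0e)
          · exact Finset.mem_union_right _ (Finset.mem_union_left _
              (Finset.mem_erase.2 ⟨hl0, h' ▸ hl⟩))
        · exact Finset.mem_union_right _ (Finset.mem_union_right _ (Finset.mem_biUnion.2
            ⟨x, Finset.mem_erase.2 ⟨h', Finset.mem_erase.2 ⟨h, hx⟩⟩, hl⟩))
      have h1 := Finset.card_le_card hu
      have h1a := Finset.card_union_le (modDivisors M e) ((modDivisors M m).erase l₀ ∪
            ((T.erase e).erase m).biUnion (modDivisors M))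
      have h1b := Finset.card_union_le ((modDivisors M m).erase l₀)
            (((T.erase e).erase m).biUnion (modDivisors M))
      have h2 := Finset.card_biUnion_le_card_mul ((T.erase e).erase m) (modDivisors M) g
        (fun x hx => deg x (Finset.mem_of_mem_erase (Finset.mem_of_mem_erase hx))
          (Finset.ne_of_mem_erase (Finset.mem_of_mem_erase hx)))
      rw [Finset.card_univ, Fintype.card_fin] at h1
      have hc2 : 0 < (T.erase e).card := Finset.card_pos.2 ⟨m, hmT'⟩
      rw [Finset.card_erase_of_mem hmT', Finset.card_erase_of_mem heT] at h2
      rw [Finset.card_erase_of_mem heT] at hc2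
      have := D.card
      obtain ⟨r, hr⟩ : ∃ r, T.card = r + 2 := ⟨T.card - 2, by omega⟩
      rw [hr] at h2
      simp only [show r + 2 - 1 - 1 = r by omega] at h2
      rw [← hTeq, hr] at this
      nlinarith
    constructor
    · intro hd
      have h := deg m hmT hme
      rw [Finset.card_erase_of_mem (mem_modDivisors.2 hd)] at key
      have := D.one_le
      omega
    · by_contra hle
      have hem : (modDivisors M m).erase l₀ = ∅ := by
        apply Finset.eq_empty_of_forall_notMem
        intro l hl
        have hd := mem_modDivisors.1 (Finset.mem_of_mem_erase hl)
        have hlt := D.least_lt l (Finset.ne_of_mem_erase hl)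
        have := Int.le_of_dvd (abs_pos.2 (ne0 m hmT)) ((dvd_abs _ _).2 hd)
        omega
      rw [hem] at key
      have := D.one_le
      simp at key
      omega

/-! ### Counting functions of integer families -/

/-- The number of members of the family `x` below the cut `u`. -/
def countBelow {N : ℕ} (x : Fin N → ℤ) (u : ℤ) : ℤ := ∑ i, if x i < u then 1 else 0

lemma countBelow_mono {N : ℕ} (x : Fin N → ℤ) {u v : ℤ} (h : u ≤ v) :
    countBelow x u ≤ countBelow x v := by
  apply Finset.sum_le_sum
  intro i _
  split_ifs <;> omega

lemma countBelow_nonneg {N : ℕ} (x : Fin N → ℤ) (u : ℤ) : 0 ≤ countBelow x u :=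
  Finset.sum_nonneg fun i _ => by split_ifs <;> omega

lemma countBelow_le {N : ℕ} (x : Fin N → ℤ) (u : ℤ) : countBelow x u ≤ N := by
  have : countBelow x u ≤ ∑ _i : Fin N, (1 : ℤ) :=
    Finset.sum_le_sum fun i _ => by split_ifs <;> omega
  simpa using this

lemma exists_lt_of_countBelow_pos {N : ℕ} {x : Fin N → ℤ} {u : ℤ} (h : 0 < countBelow x u) :
    ∃ i, x i < u := by
  by_contra! hne
  have : countBelow x u = 0 := Finset.sum_eq_zero fun i _ => by
    have := hne i
    split_ifs <;> omega
  omega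

lemma exists_ge_of_countBelow_lt {N : ℕ} {x : Fin N → ℤ} {u : ℤ} (h : countBelow x u < N) :
    ∃ i, u ≤ x i := by
  by_contra! hne
  have : countBelow x u = ∑ _i : Fin N, (1 : ℤ) := Finset.sum_congr rfl fun i _ => by
    have := hne i
    split_ifs <;> omega
  simp at this
  omega

lemma countBelow_succ {N : ℕ} (x : Fin N → ℤ) (u : ℤ) :
    countBelow x (u + 1) = countBelow x u + ∑ i, if x i = u then 1 else 0 := by
  unfold countBelow
  rw [← Finset.sum_add_distrib]
  apply Finset.sum_congr rfl
  intro i _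
  split_ifs <;> omega

lemma sum_ite_eq_zero_of_forall_ne {N : ℕ} {x : Fin N → ℤ} {u : ℤ} (h : ∀ i, x i ≠ u) :
    (∑ i, if x i = u then (1 : ℤ) else 0) = 0 :=
  Finset.sum_eq_zero fun i _ => by simp [h i]

/-- The number of cuts `v + n R`, `|n| ≤ K`, lying above `x`. -/
lemma sum_ite_lt_add_mul {R : ℤ} (hR : 0 < R) (x v : ℤ) {K : ℕ}
    (h1 : -(K : ℤ) - 1 ≤ (x - v) / R) (h2 : (x - v) / R ≤ K) :
    (∑ n ∈ Finset.Icc (-(K : ℤ)) K, if x < v + n * R then (1 : ℤ) else 0)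
      = K - (x - v) / R := by
  rw [Finset.sum_ite, Finset.sum_const_zero, add_zero, Finset.sum_const]
  have : (Finset.Icc (-(K : ℤ)) K).filter (fun n => x < v + n * R)
      = Finset.Ioc ((x - v) / R) K := by
    ext n
    have : x < v + n * R ↔ (x - v) / R < n := by
      rw [Int.ediv_lt_iff_lt_mul hR]
      constructor <;> intro h <;> linarith
    simp only [Finset.mem_filter, Finset.mem_Icc, Finset.mem_Ioc, this]
    constructor <;> intro h <;> omega
  rw [this, Int.card_Ioc]
  simp
  omega

lemma ediv_sub_succ {Q : ℤ} (hQ : 0 < Q) (x u : ℤ) :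
    (x - (u + 1)) / Q = (x - u) / Q - if Q ∣ x - u then 1 else 0 := by
  have h1 := Int.emod_add_mul_ediv (x - u) Q
  have h2 := Int.emod_nonneg (x - u) hQ.ne'
  have h3 := Int.emod_lt_of_pos (x - u) hQ
  split_ifs with hd
  · have h0 := Int.emod_eq_zero_of_dvd hd
    rw [h0] at h1
    rw [Int.ediv_eq_iff_of_pos hQ]
    constructor <;> nlinarith
  · have h0 : (x - u) % Q ≠ 0 := fun h => hd (Int.dvd_of_emod_eq_zero h)
    rw [sub_zero, Int.ediv_eq_iff_of_pos hQ]
    constructor <;> nlinarith [lt_of_le_of_ne h2 (Ne.symm h0)]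

/-! ### Surpluses on the line and on the circle -/

section Surplus

variable {N : ℕ} (a b : Fin N → ℤ) (Q : ℤ)

/-- The number of `b j < t + Q` minus the number of `a i < t`; it is nonnegative for all `t` iff
the `k`-th smallest `b` is at most `Q` plus the `k`-th smallest `a`, for every `k`. -/
def headSurplus (t : ℤ) : ℤ := countBelow b (t + Q) - countBelow a t

/-- The number of `b j < s` minus the number of `a i < s`; it is nonpositive for all `s` iff the
`k`-th smallest `a` is at most the `k`-th smallest `b`, for every `k`. -/
def tailSurplus (s : ℤ) : ℤ := countBelow b s - countBelow a s

/-- For `s ≤ t` this is the number of `b j` in the translate `[s, t + Q) + m Q` minus the number of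
`a i` in the translate `[s, t) + m Q`. -/
def windowSurplus (s t m : ℤ) : ℤ := headSurplus a b Q (t + m * Q) - tailSurplus a b (s + m * Q)

/-- The `Q`-periodic function that drops by one at the classes of the `a i` and rises by one at the
classes of the `b j` modulo `Q`. -/
def winding (u : ℤ) : ℤ := ∑ i, ((a i - u) / Q - (b i - u) / Q)

variable {a b Q}

lemma tailSurplus_le_headSurplus {t u : ℤ} (h1 : t ≤ u) (h2 : u ≤ t + Q) :
    tailSurplus a b u ≤ headSurplus a b Q t := by
  have := countBelow_mono a h1
  have := countBelow_mono b h2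
  unfold tailSurplus headSurplus
  omega

/-- The total surplus over the translates by multiples of `R Q`, in terms of integer parts. -/
lemma sum_windowSurplus (hQ : 0 < Q) {R : ℤ} (hR : 0 < R) (s t : ℤ) :
    ∃ K₀ : ℕ, ∀ K : ℕ, K₀ ≤ K →
      ∑ n ∈ Finset.Icc (-(K : ℤ)) K, windowSurplus a b Q s t (n * R) =
        ∑ i, ((b i - s) / (R * Q) - (b i - (t + Q)) / (R * Q)
          + ((a i - t) / (R * Q) - (a i - s) / (R * Q))) := by
  have hRQ : 0 < R * Q := mul_pos hR hQ
  set f : Fin N → ℕ := fun i => ((b i - s) / (R * Q)).natAbs + ((b i - (t + Q)) / (R * Q)).natAbs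
    + ((a i - t) / (R * Q)).natAbs + ((a i - s) / (R * Q)).natAbs with hf
  refine ⟨∑ i, f i, fun K hK => ?_⟩
  have hle : ∀ i, f i ≤ K := fun i =>
    (Finset.single_le_sum (f := f) (fun _ _ => Nat.zero_le _) (Finset.mem_univ i)).trans hK
  simp only [windowSurplus, headSurplus, tailSurplus, countBelow]
  simp only [← Finset.sum_sub_distrib]
  rw [Finset.sum_comm]
  apply Finset.sum_congr rfl
  intro i _
  have hi := hle i
  simp only [hf] at hi
  simp only [Finset.sum_sub_distrib]
  have e1 := sum_ite_lt_add_mul hRQ (b i) (t + Q) (K := K) (by omega) (by omega)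
  have e2 := sum_ite_lt_add_mul hRQ (a i) t (K := K) (by omega) (by omega)
  have e3 := sum_ite_lt_add_mul hRQ (b i) s (K := K) (by omega) (by omega)
  have e4 := sum_ite_lt_add_mul hRQ (a i) s (K := K) (by omega) (by omega)
  have r1 : ∀ n : ℤ, t + n * R * Q + Q = t + Q + n * (R * Q) := fun n => by ring
  have r2 : ∀ n v : ℤ, v + n * R * Q = v + n * (R * Q) := fun n v => by ring
  simp only [r1]
  simp only [r2]
  rw [e1, e2, e3, e4]
  ring

lemma windowSurplus_eq_zero (hQ : 0 < Q) (s t : ℤ) :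
    ∃ K₀ : ℕ, ∀ K : ℕ, K₀ ≤ K → ∀ m, windowSurplus a b Q s t m ≠ 0 →
      m ∈ Finset.Icc (-(K : ℤ)) K := by
  refine ⟨∑ i, ((a i).natAbs + (b i).natAbs) + s.natAbs + t.natAbs + 1, fun K hK m hm => ?_⟩
  have hle : ∀ i, (a i).natAbs + (b i).natAbs ≤ ∑ i, ((a i).natAbs + (b i).natAbs) := fun i =>
    Finset.single_le_sum (f := fun i => (a i).natAbs + (b i).natAbs)
      (fun _ _ => Nat.zero_le _) (Finset.mem_univ i)
  by_contra hmem
  apply hm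
  rw [Finset.mem_Icc, not_and_or] at hmem
  have hlow : ∀ (x : Fin N → ℤ) (u : ℤ), (∀ i, u ≤ x i) → countBelow x u = 0 := fun x u h =>
    Finset.sum_eq_zero fun i _ => by have := h i; split_ifs <;> omega
  have hhigh : ∀ (x : Fin N → ℤ) (u : ℤ), (∀ i, x i < u) → countBelow x u = N := fun x u h => by
    rw [countBelow, Finset.sum_congr rfl fun i _ => if_pos (h i)]
    simp
  unfold windowSurplus headSurplus tailSurplus
  rcases hmem with h | h
  · have : m * Q ≤ -((K : ℤ) * Q) - Q := by nlinarith
    have : (K : ℤ) * Q ≥ K := by nlinarith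
    rw [hlow, hlow, hlow, hlow]
    · simp
    all_goals intro i; have := hle i; omega
  · have : m * Q ≥ (K : ℤ) * Q + Q := by nlinarith
    have : (K : ℤ) * Q ≥ K := by nlinarith
    rw [hhigh, hhigh, hhigh, hhigh]
    · simp
    all_goals intro i; have := hle i; omega

/-- The total surplus over all translates. -/
lemma sum_windowSurplus_one (hQ : 0 < Q) (s t : ℤ) :
    ∃ K : ℕ, (∀ m, windowSurplus a b Q s t m ≠ 0 → m ∈ Finset.Icc (-(K : ℤ)) K) ∧
      ∑ m ∈ Finset.Icc (-(K : ℤ)) K, windowSurplus a b Q s t m =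
        N + winding a b Q t - winding a b Q s := by
  obtain ⟨K₁, h1⟩ := windowSurplus_eq_zero (a := a) (b := b) hQ s t
  obtain ⟨K₂, h2⟩ := sum_windowSurplus (a := a) (b := b) hQ one_pos s t
  refine ⟨max K₁ K₂, h1 _ (le_max_left _ _), ?_⟩
  have := h2 (max K₁ K₂) (le_max_right _ _)
  simp only [mul_one, one_mul] at this
  rw [this, winding, winding]
  have hN : (N : ℤ) = ∑ _i : Fin N, (1 : ℤ) := by simp
  rw [hN, ← Finset.sum_add_distrib, ← Finset.sum_sub_distrib]
  apply Finset.sum_congr rfl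
  intro i _
  have : (b i - (t + Q)) / Q = (b i - t) / Q - 1 := by
    rw [show b i - (t + Q) = b i - t + (-1) * Q by ring, Int.add_mul_ediv_right _ _ hQ.ne']
    ring
  rw [this]
  ring

lemma winding_add_mul (hQ : 0 < Q) (u m : ℤ) : winding a b Q (u + m * Q) = winding a b Q u := by
  unfold winding
  apply Finset.sum_congr rfl
  intro i _
  rw [show a i - (u + m * Q) = a i - u + (-m) * Q by ring,
    show b i - (u + m * Q) = b i - u + (-m) * Q by ring,
    Int.add_mul_ediv_right _ _ hQ.ne', Int.add_mul_ediv_right _ _ hQ.ne']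
  ring

lemma winding_congr (hQ : 0 < Q) {u v : ℤ} (h : Q ∣ u - v) :
    winding a b Q u = winding a b Q v := by
  obtain ⟨m, hm⟩ := h
  rw [← winding_add_mul hQ v m]
  congr 1
  linarith

lemma winding_succ (hQ : 0 < Q) (u : ℤ) :
    winding a b Q (u + 1) = winding a b Q u - (∑ i, if Q ∣ a i - u then 1 else 0)
      + ∑ i, if Q ∣ b i - u then 1 else 0 := by
  unfold winding
  rw [← Finset.sum_sub_distrib, ← Finset.sum_add_distrib]
  apply Finset.sum_congr rfl
  intro i _
  rw [ediv_sub_succ hQ, ediv_sub_succ hQ]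
  ring

lemma exists_winding_max (hQ : 0 < Q) : ∃ s, ∀ u, winding a b Q u ≤ winding a b Q s := by
  obtain ⟨s, _, hs⟩ := Finset.exists_max_image (Finset.Ico 0 Q) (winding a b Q)
    ⟨0, by simp [hQ]⟩
  refine ⟨s, fun u => ?_⟩
  have : winding a b Q u = winding a b Q (u % Q) :=
    winding_congr hQ (Int.dvd_self_sub_emod)
  rw [this]
  exact hs _ (Finset.mem_Ico.2 ⟨Int.emod_nonneg _ hQ.ne', Int.emod_lt_of_pos _ hQ⟩)

lemma exists_winding_min (hQ : 0 < Q) (v : ℤ) :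
    ∃ s, v ≤ s ∧ s < v + Q ∧ ∀ u, winding a b Q s ≤ winding a b Q u := by
  obtain ⟨s, hs1, hs⟩ := Finset.exists_min_image (Finset.Ico v (v + Q)) (winding a b Q)
    ⟨v, by simp [hQ]⟩
  rw [Finset.mem_Ico] at hs1
  refine ⟨s, hs1.1, hs1.2, fun u => ?_⟩
  have : winding a b Q u = winding a b Q (v + (u - v) % Q) := by
    apply winding_congr hQ
    have := Int.dvd_self_sub_emod (x := u - v) (m := Q)
    rwa [show u - (v + (u - v) % Q) = u - v - (u - v) % Q by ring]
  rw [this]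
  have := Int.emod_nonneg (u - v) hQ.ne'
  have := Int.emod_lt_of_pos (u - v) hQ
  exact hs _ (Finset.mem_Ico.2 ⟨by omega, by omega⟩)

end Surplus

/-! ### Matchings on circles -/

/-- `a` and `b` can be matched on the circle of length `m Q` so that each `b j` follows its partner
within less than `Q`. -/
def CircleMatch {N : ℕ} (a b : Fin N → ℤ) (Q : ℤ) (m : ℕ) : Prop :=
  ∃ π : Equiv.Perm (Fin N), ∀ i, ∃ k : ℤ, (m : ℤ) ∣ k ∧
    0 < b (π i) - a i + k * Q ∧ b (π i) - a i + k * Q < Q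

/-- Hall's inequality for arcs: the translates of `[s, t)` by multiples of `m Q` contain at most as
many `a i` as those of `[s, t + Q)` contain `b j`. With the `b j` listed in the order of their
partners it holds partner by partner, because integer parts are monotone. -/
lemma CircleMatch.exists_pos {N : ℕ} {a b : Fin N → ℤ} {Q : ℤ} (hQ : 0 < Q) {m : ℕ} (hm : 0 < m)
    (h : CircleMatch a b Q m) {s t : ℤ} (hneg : windowSurplus a b Q s t 0 < 0) :
    ∃ k : ℤ, k ≠ 0 ∧ (m : ℤ) ∣ k ∧ 0 < windowSurplus a b Q s t k := by
  obtain ⟨π, hπ⟩ := h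
  have hm' : (0 : ℤ) < m := by exact_mod_cast hm
  have hR : 0 < (m : ℤ) * Q := mul_pos hm' hQ
  obtain ⟨K, hK⟩ := sum_windowSurplus (a := a) (b := b) hQ hm' s t
  have hsum := hK K le_rfl
  have hnn : 0 ≤ ∑ i, ((b i - s) / (m * Q) - (b i - (t + Q)) / (m * Q)
          + ((a i - t) / (m * Q) - (a i - s) / (m * Q))) := by
    rw [Finset.sum_add_distrib, ← Equiv.sum_comp π, ← Finset.sum_add_distrib]
    apply Finset.sum_nonneg
    intro i _
    obtain ⟨k, ⟨c, rfl⟩, h1, h2⟩ := hπ i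
    have e1 : ∀ v, (b (π i) - v) / (m * Q) = (b (π i) + m * c * Q - v) / (m * Q) - c := by
      intro v
      rw [show b (π i) + m * c * Q - v = b (π i) - v + c * (m * Q) by ring,
        Int.add_mul_ediv_right _ _ hR.ne']
      ring
    rw [e1 s, e1 (t + Q)]
    have h3 : (a i - s) / (m * Q) ≤ (b (π i) + m * c * Q - s) / (m * Q) :=
      Int.ediv_le_ediv hR (by linarith)
    have h4 : (b (π i) + m * c * Q - (t + Q)) / (m * Q) ≤ (a i - t) / (m * Q) :=
      Int.ediv_le_ediv hR (by linarith)
    linarith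
  by_contra! hcon
  have : ∑ n ∈ Finset.Icc (-(K : ℤ)) K, windowSurplus a b Q s t (n * m) < 0 := by
    have h0 : (0 : ℤ) ∈ Finset.Icc (-(K : ℤ)) K := by simp
    have : ∑ n ∈ Finset.Icc (-(K : ℤ)) K, windowSurplus a b Q s t (n * m)
        < ∑ n ∈ Finset.Icc (-(K : ℤ)) K, (0 : ℤ) := by
      apply Finset.sum_lt_sum
      · intro n _
        by_cases hn : n = 0
        · simp [hn, hneg.le]
        · exact hcon _ (mul_ne_zero hn hm'.ne') (dvd_mul_left _ _)
      · exact ⟨0, h0, by simpa using hneg⟩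
    simpa using this
  rw [hsum] at this
  omega

/-! ### Generic configurations and extremal windows -/

/-- Integer positions, `Q` units to a turn, that occupy pairwise different classes modulo `Q`; the
`a i` lie in `[0, (P - 1) Q)` and the `b j` in the same interval moved by half a turn. -/
structure GenericConfig {N : ℕ} (a b : Fin N → ℤ) (Q : ℤ) (P : ℕ) : Prop where
  turn_pos : 0 < Q
  a_inj : ∀ i i', Q ∣ a i - a i' → i = i'
  b_inj : ∀ j j', Q ∣ b j - b j' → j = j'
  a_b : ∀ i j, ¬ Q ∣ a i - b j
  a_nonneg : ∀ i, 0 ≤ a i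
  a_lt : ∀ i, a i < (P - 1) * Q
  le_b : ∀ j, Q ≤ 2 * b j
  b_lt : ∀ j, 2 * b j < (2 * P - 1) * Q

namespace GenericConfig

variable {N : ℕ} {a b : Fin N → ℤ} {Q : ℤ} {P : ℕ}

lemma headSurplus_pos (E : GenericConfig a b Q P) {t : ℤ} (h : 0 < headSurplus a b Q t) :
    -Q < 2 * t ∧ t < (P - 1) * Q := by
  unfold headSurplus at h
  have := countBelow_nonneg a t
  have := countBelow_le b (t + Q)
  obtain ⟨j, hj⟩ := exists_lt_of_countBelow_pos (x := b) (u := t + Q) (by omega)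
  obtain ⟨i, hi⟩ := exists_ge_of_countBelow_lt (x := a) (u := t) (by omega)
  have := E.le_b j
  have := E.a_lt i
  constructor <;> linarith

lemma headSurplus_neg (E : GenericConfig a b Q P) {t : ℤ} (h : headSurplus a b Q t < 0) :
    0 < t ∧ 2 * t < (2 * P - 3) * Q := by
  unfold headSurplus at h
  have := countBelow_nonneg b (t + Q)
  have := countBelow_le a t
  obtain ⟨i, hi⟩ := exists_lt_of_countBelow_pos (x := a) (u := t) (by omega)
  obtain ⟨j, hj⟩ := exists_ge_of_countBelow_lt (x := b) (u := t + Q) (by omega)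
  have := E.b_lt j
  have := E.a_nonneg i
  constructor <;> linarith

lemma tailSurplus_neg (E : GenericConfig a b Q P) {s : ℤ} (h : tailSurplus a b s < 0) :
    0 < s ∧ 2 * s < (2 * P - 1) * Q := by
  unfold tailSurplus at h
  have := countBelow_nonneg b s
  have := countBelow_le a s
  obtain ⟨i, hi⟩ := exists_lt_of_countBelow_pos (x := a) (u := s) (by omega)
  obtain ⟨j, hj⟩ := exists_ge_of_countBelow_lt (x := b) (u := s) (by omega)
  have := E.b_lt j
  have := E.a_nonneg i
  constructor <;> linarith

lemma tailSurplus_pos (E : GenericConfig a b Q P) {s : ℤ} (h : 0 < tailSurplus a b s) :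
    Q < 2 * s ∧ s < (P - 1) * Q := by
  unfold tailSurplus at h
  have := countBelow_nonneg a s
  have := countBelow_le b s
  obtain ⟨j, hj⟩ := exists_lt_of_countBelow_pos (x := b) (u := s) (by omega)
  obtain ⟨i, hi⟩ := exists_ge_of_countBelow_lt (x := a) (u := s) (by omega)
  have := E.le_b j
  have := E.a_lt i
  constructor <;> linarith

lemma tailSurplus_eq_zero_of_nonpos (E : GenericConfig a b Q P) {s : ℤ} (h : s ≤ 0) :
    tailSurplus a b s = 0 := by
  have hQ := E.turn_pos
  rcases lt_trichotomy (tailSurplus a b s) 0 with h' | h' | h'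
  · have := E.tailSurplus_neg h'; omega
  · exact h'
  · have := E.tailSurplus_pos h'; omega

lemma tailSurplus_eq_zero_of_ge (E : GenericConfig a b Q P) {s : ℤ}
    (h : (2 * P - 1) * Q ≤ 2 * s) : tailSurplus a b s = 0 := by
  have hQ := E.turn_pos
  rcases lt_trichotomy (tailSurplus a b s) 0 with h' | h' | h'
  · have := (E.tailSurplus_neg h').2; omega
  · exact h'
  · have := (E.tailSurplus_pos h').2; linarith

lemma sum_a_eq (E : GenericConfig a b Q P) (i₀ : Fin N) (m : ℤ) :
    (∑ i, if a i = a i₀ + m * Q then (1 : ℤ) else 0) = if m = 0 then 1 else 0 := by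
  have : ∀ i, a i = a i₀ + m * Q ↔ i = i₀ ∧ m = 0 := by
    intro i
    constructor
    · intro h
      have hi : i = i₀ := E.a_inj i i₀ ⟨m, by rw [h]; ring⟩
      subst hi
      have : m * Q = 0 := by linarith
      exact ⟨rfl, (mul_eq_zero.1 this).resolve_right E.turn_pos.ne'⟩
    · rintro ⟨rfl, rfl⟩; ring
  simp only [this]
  by_cases hm : m = 0 <;> simp [hm]

lemma sum_b_eq (E : GenericConfig a b Q P) (j₀ : Fin N) (m : ℤ) :
    (∑ j, if b j = b j₀ + m * Q then (1 : ℤ) else 0) = if m = 0 then 1 else 0 := by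
  have : ∀ j, b j = b j₀ + m * Q ↔ j = j₀ ∧ m = 0 := by
    intro j
    constructor
    · intro h
      have hj : j = j₀ := E.b_inj j j₀ ⟨m, by rw [h]; ring⟩
      subst hj
      have : m * Q = 0 := by linarith
      exact ⟨rfl, (mul_eq_zero.1 this).resolve_right E.turn_pos.ne'⟩
    · rintro ⟨rfl, rfl⟩; ring
  simp only [this]
  by_cases hm : m = 0 <;> simp [hm]

lemma sum_b_eq_a (E : GenericConfig a b Q P) (i : Fin N) (m : ℤ) :
    (∑ j, if b j = a i + m * Q then (1 : ℤ) else 0) = 0 :=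
  sum_ite_eq_zero_of_forall_ne fun j h => E.a_b i j ⟨-m, by rw [h]; ring⟩

lemma sum_a_eq_b (E : GenericConfig a b Q P) (j : Fin N) (m : ℤ) :
    (∑ i, if a i = b j + m * Q then (1 : ℤ) else 0) = 0 :=
  sum_ite_eq_zero_of_forall_ne fun i h => E.a_b i j ⟨m, by rw [h]; ring⟩

lemma winding_succ_a (E : GenericConfig a b Q P) (i : Fin N) :
    winding a b Q (a i + 1) = winding a b Q (a i) - 1 := by
  rw [winding_succ E.turn_pos]
  have h1 : (∑ i', if Q ∣ a i' - a i then (1 : ℤ) else 0) = 1 := by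
    rw [Finset.sum_eq_single i]
    · simp
    · intro i' _ hne
      rw [if_neg fun h => hne (E.a_inj _ _ h)]
    · simp
  have h2 : (∑ j, if Q ∣ b j - a i then (1 : ℤ) else 0) = 0 :=
    Finset.sum_eq_zero fun j _ => if_neg fun h => E.a_b i j ((dvd_sub_comm).1 h)
  rw [h1, h2]
  ring

lemma winding_succ_b (E : GenericConfig a b Q P) (j : Fin N) :
    winding a b Q (b j + 1) = winding a b Q (b j) + 1 := by
  rw [winding_succ E.turn_pos]
  have h1 : (∑ i, if Q ∣ a i - b j then (1 : ℤ) else 0) = 0 :=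
    Finset.sum_eq_zero fun i _ => if_neg fun h => E.a_b i j h
  have h2 : (∑ j', if Q ∣ b j' - b j then (1 : ℤ) else 0) = 1 := by
    rw [Finset.sum_eq_single j]
    · simp
    · intro j' _ hne
      rw [if_neg fun h => hne (E.b_inj _ _ h)]
    · simp
  rw [h1, h2]
  ring

lemma headSurplus_succ (t : ℤ) : headSurplus a b Q (t + 1) = headSurplus a b Q t
    + (∑ j, if b j = t + Q then 1 else 0) - ∑ i, if a i = t then 1 else 0 := by
  unfold headSurplus
  rw [show t + 1 + Q = t + Q + 1 by ring, countBelow_succ, countBelow_succ]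
  ring

lemma tailSurplus_succ (s : ℤ) : tailSurplus a b (s + 1) = tailSurplus a b s
    + (∑ j, if b j = s then 1 else 0) - ∑ i, if a i = s then 1 else 0 := by
  unfold tailSurplus
  rw [countBelow_succ, countBelow_succ]
  ring

/-- If raising `t` by one turns a nonnegative window surplus negative at the base window, it passes
an `a i`, and no other window is affected. -/
lemma step_head_up (E : GenericConfig a b Q P) {s t : ℤ}
    (hnn : ∀ m, 0 ≤ windowSurplus a b Q s t m) (hneg : windowSurplus a b Q s (t + 1) 0 < 0) :
    (∃ i, a i = t) ∧ windowSurplus a b Q s (t + 1) 0 = -1 ∧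
      (∀ m, m ≠ 0 → 0 ≤ windowSurplus a b Q s (t + 1) m) ∧
      winding a b Q (t + 1) = winding a b Q t - 1 := by
  have hi : ∃ i, a i = t := by
    by_contra! hne
    have h0 := hnn 0
    simp only [windowSurplus, zero_mul, add_zero] at h0 hneg
    rw [headSurplus_succ, sum_ite_eq_zero_of_forall_ne hne] at hneg
    have : (0 : ℤ) ≤ ∑ j, if b j = t + Q then (1 : ℤ) else 0 :=
      Finset.sum_nonneg fun j _ => by split_ifs <;> omega
    omega
  obtain ⟨i, rfl⟩ := hi
  have hstep : ∀ m, windowSurplus a b Q s (a i + 1) m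
      = windowSurplus a b Q s (a i) m - if m = 0 then 1 else 0 := by
    intro m
    unfold windowSurplus
    rw [show a i + 1 + m * Q = a i + m * Q + 1 by ring, headSurplus_succ, E.sum_a_eq,
      show a i + m * Q + Q = a i + (m + 1) * Q by ring, E.sum_b_eq_a]
    ring
  refine ⟨⟨i, rfl⟩, ?_, ?_, E.winding_succ_a i⟩
  · have h0 := hnn 0
    rw [hstep 0, if_pos rfl] at hneg ⊢
    omega
  · intro m hm
    rw [hstep m, if_neg hm, sub_zero]
    exact hnn m

/-- If lowering `t` by one turns a nonnegative window surplus negative at the base window, it passes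
a `b j - Q`, and no other window is affected. -/
lemma step_head_down (E : GenericConfig a b Q P) {s t : ℤ}
    (hnn : ∀ m, 0 ≤ windowSurplus a b Q s (t + 1) m) (hneg : windowSurplus a b Q s t 0 < 0) :
    (∃ j, b j = t + Q) ∧ windowSurplus a b Q s t 0 = -1 ∧
      (∀ m, m ≠ 0 → 0 ≤ windowSurplus a b Q s t m) ∧
      winding a b Q (t + 1) = winding a b Q t + 1 := by
  have hj : ∃ j, b j = t + Q := by
    by_contra! hne
    have h0 := hnn 0
    simp only [windowSurplus, zero_mul, add_zero] at h0 hneg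
    rw [headSurplus_succ, sum_ite_eq_zero_of_forall_ne hne] at h0
    have : (0 : ℤ) ≤ ∑ i, if a i = t then (1 : ℤ) else 0 :=
      Finset.sum_nonneg fun j _ => by split_ifs <;> omega
    omega
  obtain ⟨j, hj⟩ := hj
  have hstep : ∀ m, windowSurplus a b Q s (t + 1) m
      = windowSurplus a b Q s t m + if m = 0 then 1 else 0 := by
    intro m
    unfold windowSurplus
    rw [show t + 1 + m * Q = t + m * Q + 1 by ring, headSurplus_succ,
      show t + m * Q + Q = b j + m * Q by rw [hj]; ring, E.sum_b_eq,
      show t + m * Q = b j + (m - 1) * Q by rw [hj]; ring, E.sum_a_eq_b]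
    ring
  refine ⟨⟨j, hj⟩, ?_, ?_, ?_⟩
  · have h0 := hnn 0
    rw [hstep 0, if_pos rfl] at h0
    omega
  · intro m hm
    have := hnn m
    rwa [hstep m, if_neg hm, add_zero] at this
  · have e1 : winding a b Q (t + 1) = winding a b Q (b j + 1) :=
      winding_congr E.turn_pos ⟨-1, by rw [hj]; ring⟩
    have e2 : winding a b Q t = winding a b Q (b j) :=
      winding_congr E.turn_pos ⟨-1, by rw [hj]; ring⟩
    rw [e1, e2, E.winding_succ_b]

/-- If lowering `s` by one turns a nonnegative window surplus negative at the base window, it passes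
an `a i`, and no other window is affected. -/
lemma step_tail_down (E : GenericConfig a b Q P) {s t : ℤ}
    (hnn : ∀ m, 0 ≤ windowSurplus a b Q (s + 1) t m) (hneg : windowSurplus a b Q s t 0 < 0) :
    (∃ i, a i = s) ∧ windowSurplus a b Q s t 0 = -1 ∧
      (∀ m, m ≠ 0 → 0 ≤ windowSurplus a b Q s t m) ∧
      winding a b Q (s + 1) = winding a b Q s - 1 := by
  have hi : ∃ i, a i = s := by
    by_contra! hne
    have h0 := hnn 0
    simp only [windowSurplus, zero_mul, add_zero] at h0 hneg
    rw [tailSurplus_succ, sum_ite_eq_zero_of_forall_ne hne] at h0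
    have : (0 : ℤ) ≤ ∑ j, if b j = s then (1 : ℤ) else 0 :=
      Finset.sum_nonneg fun j _ => by split_ifs <;> omega
    omega
  obtain ⟨i, rfl⟩ := hi
  have hstep : ∀ m, windowSurplus a b Q (a i + 1) t m
      = windowSurplus a b Q (a i) t m + if m = 0 then 1 else 0 := by
    intro m
    unfold windowSurplus
    rw [show a i + 1 + m * Q = a i + m * Q + 1 by ring, tailSurplus_succ, E.sum_a_eq,
      E.sum_b_eq_a]
    ring
  refine ⟨⟨i, rfl⟩, ?_, ?_, E.winding_succ_a i⟩
  · have h0 := hnn 0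
    rw [hstep 0, if_pos rfl] at h0
    omega
  · intro m hm
    have := hnn m
    rwa [hstep m, if_neg hm, add_zero] at this

end GenericConfig

/-- Along a sequence of integer functions that starts nonnegative and does not stay so, there is a
last index before the first negative value. -/
lemma exists_last_nonneg {F : ℕ → ℤ → ℤ} (h0 : ∀ m, 0 ≤ F 0 m) {n₀ : ℕ} {m₀ : ℤ}
    (hneg : F n₀ m₀ < 0) :
    ∃ n, n + 1 ≤ n₀ ∧ (∀ n' ≤ n, ∀ m, 0 ≤ F n' m) ∧ ∃ p, F (n + 1) p < 0 := by
  classical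
  have hex : ∃ n, ∃ p, F n p < 0 := ⟨n₀, m₀, hneg⟩
  have hpos : Nat.find hex ≠ 0 := by
    intro h
    obtain ⟨p, hp⟩ := Nat.find_spec hex
    rw [h] at hp
    exact absurd (h0 p) (by omega)
  obtain ⟨n, hn⟩ := Nat.exists_eq_succ_of_ne_zero hpos
  refine ⟨n, ?_, ?_, ?_⟩
  · have := Nat.find_min' hex ⟨m₀, hneg⟩; omega
  · intro n' hn' m
    by_contra hlt
    exact Nat.find_min hex (m := n') (by omega) ⟨m, by omega⟩
  · have := Nat.find_spec hex
    rwa [hn] at this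

section Extremal

variable {N L g P : ℕ} {M : Fin L → ℕ} {l₀ : Fin L} {a b : Fin N → ℤ} {Q : ℤ}

/-- The saturation lemma for a window surplus with base value `-1`. -/
lemma windowSurplus_saturated (E : GenericConfig a b Q P) (D : ModuliData N g P M l₀)
    (hC : ∀ l, CircleMatch a b Q (M l)) {s t : ℤ} (h0 : windowSurplus a b Q s t 0 = -1)
    (hnn : ∀ m, m ≠ 0 → 0 ≤ windowSurplus a b Q s t m)
    (hw : winding a b Q t < winding a b Q s) {e : ℤ} (he : e = P ∨ e = -P)
    (hrange : ∀ m, 0 < windowSurplus a b Q s t m → |m| < P ∨ m = e) :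
    0 < windowSurplus a b Q s t e ∧ (∀ m, windowSurplus a b Q s t m ≤ 1) ∧
      winding a b Q t = winding a b Q s - 1 ∧
      ∀ m, m ≠ e → 0 < windowSurplus a b Q s t m → ¬ (M l₀ : ℤ) ∣ m ∧ (M l₀ : ℤ) < |m| := by
  obtain ⟨K, hK, hsum⟩ := sum_windowSurplus_one (a := a) (b := b) E.turn_pos s t
  obtain ⟨c1, c2, c3, c4⟩ := saturated_of_cover D h0 hnn hK (by omega)
    (fun l => (hC l).exists_pos E.turn_pos (D.pos l) (by omega)) he hrange
  exact ⟨c1, c2, by omega, c4⟩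

/-- For a class of `s` where the winding is maximal, shrink the windows `[s, t)` to the shortest
deficient one. It starts less than a turn, but more than half a turn, before the origin, and ends
at the first place where the head surplus is negative. -/
lemma exists_upper_base (E : GenericConfig a b Q P) (D : ModuliData N g P M l₀)
    (hC : ∀ l, CircleMatch a b Q (M l)) {s : ℤ}
    (hs : ∀ u, winding a b Q u ≤ winding a b Q s) (hneg : ∃ t, headSurplus a b Q t < 0) :
    ∃ s₀ t₀, Q ∣ s₀ - s ∧ -Q < s₀ ∧ 2 * s₀ < -Q ∧ headSurplus a b Q t₀ = -1 ∧
      (∃ i, a i = t₀ - 1) ∧ winding a b Q (t₀ - 1) = winding a b Q s ∧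
      (∀ t < t₀, 0 ≤ headSurplus a b Q t) ∧
      (∀ m : ℤ, m ≠ 0 → m ≠ P → |m| ≤ M l₀ → windowSurplus a b Q s₀ t₀ m = 0) ∧
      ∀ u t, Q ∣ u - s₀ → u ≤ t → t - u < t₀ - s₀ →
        tailSurplus a b u ≤ headSurplus a b Q t := by
  have hQ := E.turn_pos
  obtain ⟨t, ht⟩ := hneg
  have ht0 := E.headSurplus_neg ht
  obtain ⟨n, -, hn, p, hp⟩ := exists_last_nonneg
    (F := fun n m => windowSurplus a b Q s (s + n) m)
    (n₀ := (t - s + s.natAbs * Q).toNat) (m₀ := -s.natAbs)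
    (fun m => by
      have := tailSurplus_le_headSurplus (a := a) (b := b) (t := s + m * Q) (u := s + m * Q)
        (Q := Q) le_rfl (by omega)
      simp only [windowSurplus, Nat.cast_zero, add_zero]
      omega)
    (by
      have h1 : s ≤ s.natAbs * Q := by nlinarith [Int.le_natAbs (a := s)]
      have h2 : s + (-(s.natAbs : ℤ)) * Q ≤ 0 := by linarith
      simp only [windowSurplus]
      rw [Int.toNat_of_nonneg (by linarith), E.tailSurplus_eq_zero_of_nonpos h2]
      rwa [show s + (t - s + s.natAbs * Q) + -(s.natAbs : ℤ) * Q = t by ring, sub_zero])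
  -- move the deficient window to the base position
  set s₀ := s + p * Q with hs₀
  have hshift : ∀ (k : ℕ) m, windowSurplus a b Q s₀ (s₀ + k) m
      = windowSurplus a b Q s (s + k) (p + m) := by
    intro k m
    simp only [windowSurplus, hs₀]
    congr 2 <;> ring
  have hdom : ∀ u t, Q ∣ u - s₀ → u ≤ t → t - u < n + 1 →
      tailSurplus a b u ≤ headSurplus a b Q t := by
    rintro u t ⟨c, hc⟩ h1 h2
    obtain ⟨k, hk⟩ := Int.eq_ofNat_of_zero_le (sub_nonneg.2 h1)
    have := hn k (by omega) (p + c)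
    rw [← hshift] at this
    simp only [windowSurplus] at this
    rw [show s₀ + k + c * Q = t by linarith, show s₀ + c * Q = u by linarith] at this
    omega
  obtain ⟨⟨i, hi⟩, h0, hnn, hw⟩ := E.step_head_up (s := s₀) (t := s₀ + n)
    (fun m => by rw [hshift]; exact hn n le_rfl _)
    (by
      have := hshift (n + 1) 0
      push_cast at this hp
      rw [show s₀ + n + 1 = s₀ + (n + 1) by ring, this, add_zero]
      exact hp)
  set t₀ := s₀ + n + 1 with ht₀
  have hai := E.a_nonneg i
  have hai' := E.a_lt i
  have ews : winding a b Q s₀ = winding a b Q s := winding_add_mul hQ s p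
  have hbase : headSurplus a b Q t₀ - tailSurplus a b s₀ = -1 := by
    simpa [windowSurplus] using h0
  have hs₀Q : -Q < s₀ := by
    by_contra hle
    have e1 := E.tailSurplus_eq_zero_of_nonpos (s := s₀ + Q) (by omega)
    have e2 := E.tailSurplus_eq_zero_of_nonpos (s := s₀) (by omega)
    have := hdom (s₀ + Q) t₀ ⟨1, by ring⟩ (by omega) (by omega)
    omega
  have hw' : winding a b Q (t₀ - 1) ≤ winding a b Q s := hs _
  rw [show t₀ - 1 = s₀ + n by omega] at hw'
  obtain ⟨c1, -, c3, c4⟩ := windowSurplus_saturated E D hC (s := s₀) (t := t₀) h0 hnn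
    (by omega) (e := P) (Or.inl rfl) (by
      intro m hm
      have : 0 < headSurplus a b Q (t₀ + m * Q) ∨ tailSurplus a b (s₀ + m * Q) < 0 := by
        by_contra! hcon
        simp only [windowSurplus] at hm
        omega
      rcases this with h | h
      · obtain ⟨h1, h2⟩ := E.headSurplus_pos h
        left
        rw [abs_lt]
        constructor <;> by_contra! hle <;> nlinarith
      · obtain ⟨h1, h2⟩ := E.tailSurplus_neg h
        have hm1 : m ≤ P := by by_contra! hle; nlinarith
        have hm2 : -(P : ℤ) < m := by by_contra! hle; nlinarith
        rcases hm1.lt_or_eq with h3 | h3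
        · left; rw [abs_lt]; exact ⟨hm2, h3⟩
        · exact Or.inr h3)
  have htail : tailSurplus a b (s₀ + P * Q) < 0 := by
    by_contra! hcon
    have : 0 < headSurplus a b Q (t₀ + P * Q) := by
      simp only [windowSurplus] at c1
      omega
    have := (E.headSurplus_pos this).2
    nlinarith
  have hs₀h : 2 * s₀ < -Q := by
    have := (E.tailSurplus_neg htail).2
    linarith
  have hk0 := E.tailSurplus_eq_zero_of_nonpos (s := s₀) (by omega)
  refine ⟨s₀, t₀, ⟨p, by rw [hs₀]; ring⟩, hs₀Q, hs₀h, by omega, ⟨i, by omega⟩, ?_, ?_, ?_, ?_⟩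
  · rw [show t₀ - 1 = s₀ + n by omega]
    omega
  · intro t' ht'
    by_contra! hlt
    have h1 := E.headSurplus_neg hlt
    have h2 := hdom s₀ t' ⟨0, by ring⟩ (by omega) (by omega)
    omega
  · intro m hm hmP hmle
    by_contra hne
    have := (c4 m hmP (by have := hnn m hm; omega)).2
    omega
  · intro u t' h1 h2 h3
    exact hdom u t' h1 h2 (by omega)

/-- The mirror image of `exists_upper_base`, for windows `[t, s)` read backwards: the shortest
deficient one ends less than half a turn after `P` turns, and starts where the head surplus is
`-1`. -/
lemma exists_lower_base (E : GenericConfig a b Q P) (D : ModuliData N g P M l₀)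
    (hC : ∀ l, CircleMatch a b Q (M l)) {s : ℤ}
    (hs : ∀ u, winding a b Q u ≤ winding a b Q s) (hneg : ∃ t, headSurplus a b Q t < 0) :
    ∃ s₁ t₁, Q ∣ s₁ - s ∧ P * Q < s₁ ∧ 2 * s₁ < (2 * P + 1) * Q ∧ headSurplus a b Q t₁ = -1 ∧
      (∀ m, windowSurplus a b Q s₁ t₁ m ≤ 1) ∧
      (∀ m, m ≠ 0 → 0 ≤ windowSurplus a b Q s₁ t₁ m) ∧
      (∀ m : ℤ, m ≠ -P → 0 < windowSurplus a b Q s₁ t₁ m →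
        ¬ (M l₀ : ℤ) ∣ m ∧ (M l₀ : ℤ) < |m|) ∧
      ∀ u t, Q ∣ u - s₁ → t ≤ u → u - t < s₁ - t₁ →
        tailSurplus a b u ≤ headSurplus a b Q t := by
  have hQ := E.turn_pos
  obtain ⟨t, ht⟩ := hneg
  have ht0 := E.headSurplus_neg ht
  obtain ⟨n, -, hn, p, hp⟩ := exists_last_nonneg
    (F := fun n m => windowSurplus a b Q s (s - n) m)
    (n₀ := (s + (s.natAbs + P) * Q - t).toNat) (m₀ := s.natAbs + P)
    (fun m => by
      have := tailSurplus_le_headSurplus (a := a) (b := b) (t := s + m * Q) (u := s + m * Q)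
        (Q := Q) le_rfl (by omega)
      simp only [windowSurplus, Nat.cast_zero, sub_zero]
      omega)
    (by
      have h1 : -s ≤ s.natAbs * Q := by
        have : -s ≤ s.natAbs := by omega
        nlinarith
      have h2 : P * Q ≤ s + ((s.natAbs : ℤ) + P) * Q := by linarith
      simp only [windowSurplus]
      rw [Int.toNat_of_nonneg (by linarith), E.tailSurplus_eq_zero_of_ge (by linarith)]
      rwa [show s - (s + (s.natAbs + P) * Q - t) + ((s.natAbs : ℤ) + P) * Q = t by ring, sub_zero])
  -- move the deficient window to the base position
  set s₁ := s + p * Q with hs₁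
  have hshift : ∀ (k : ℕ) m, windowSurplus a b Q s₁ (s₁ - k) m
      = windowSurplus a b Q s (s - k) (p + m) := by
    intro k m
    simp only [windowSurplus, hs₁]
    congr 2 <;> ring
  have hdom : ∀ u t, Q ∣ u - s₁ → t ≤ u → u - t < n + 1 →
      tailSurplus a b u ≤ headSurplus a b Q t := by
    rintro u t ⟨c, hc⟩ h1 h2
    obtain ⟨k, hk⟩ := Int.eq_ofNat_of_zero_le (sub_nonneg.2 h1)
    have := hn k (by omega) (p + c)
    rw [← hshift] at this
    simp only [windowSurplus] at this
    rw [show s₁ - k + c * Q = t by linarith, show s₁ + c * Q = u by linarith] at this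
    omega
  set t₁ := s₁ - (n + 1) with ht₁
  obtain ⟨⟨j, hj⟩, h0, hnn, hw⟩ := E.step_head_down (s := s₁) (t := t₁)
    (fun m => by rw [show t₁ + 1 = s₁ - n by omega, hshift]; exact hn n le_rfl _)
    (by
      have := hshift (n + 1) 0
      push_cast at this hp
      rw [ht₁, this, add_zero]
      exact hp)
  have hbj := E.le_b j
  have hbj' := E.b_lt j
  have ews : winding a b Q s₁ = winding a b Q s := winding_add_mul hQ s p
  have hbase : headSurplus a b Q t₁ - tailSurplus a b s₁ = -1 := by
    simpa [windowSurplus] using h0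
  have hs₁Q : 2 * s₁ < (2 * P + 1) * Q := by
    by_contra! hle
    have e1 := E.tailSurplus_eq_zero_of_ge (s := s₁ - Q) (by linarith)
    have e2 := E.tailSurplus_eq_zero_of_ge (s := s₁) (by linarith)
    have := E.headSurplus_neg (t := t₁) (by omega)
    have := hdom (s₁ - Q) t₁ ⟨-1, by ring⟩ (by linarith) (by linarith)
    omega
  have hw' : winding a b Q (t₁ + 1) ≤ winding a b Q s := hs _
  obtain ⟨c1, c2, c3, c4⟩ := windowSurplus_saturated E D hC (s := s₁) (t := t₁) h0 hnn
    (by omega) (e := -P) (Or.inr rfl) (by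
      intro m hm
      have : 0 < headSurplus a b Q (t₁ + m * Q) ∨ tailSurplus a b (s₁ + m * Q) < 0 := by
        by_contra! hcon
        simp only [windowSurplus] at hm
        omega
      rcases this with h | h
      · obtain ⟨h1, h2⟩ := E.headSurplus_pos h
        left
        rw [abs_lt]
        constructor <;> by_contra! hle <;> nlinarith
      · obtain ⟨h1, h2⟩ := E.tailSurplus_neg h
        have hm1 : m < P := by by_contra! hle; nlinarith
        have hm2 : -(P : ℤ) ≤ m := by by_contra! hle; nlinarith
        rcases hm2.lt_or_eq with h3 | h3
        · left; rw [abs_lt]; exact ⟨h3, hm1⟩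
        · exact Or.inr h3.symm)
  have htail : tailSurplus a b (s₁ + (-P) * Q) < 0 := by
    by_contra! hcon
    have : 0 < headSurplus a b Q (t₁ + (-P) * Q) := by
      simp only [windowSurplus] at c1
      omega
    have := (E.headSurplus_pos this).1
    nlinarith
  have hs₁P : P * Q < s₁ := by
    have := (E.tailSurplus_neg htail).1
    linarith
  have hk0 := E.tailSurplus_eq_zero_of_ge (s := s₁) (by linarith)
  refine ⟨s₁, t₁, ⟨p, by rw [hs₁]; ring⟩, hs₁P, hs₁Q, by omega, c2, hnn, c4, ?_⟩
  intro u t' h1 h2 h3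
  exact hdom u t' h1 h2 (by omega)

end Extremal

/-! ### The circular matchings force a matching on the line -/

section Line

variable {N L g P : ℕ} {M : Fin L → ℕ} {l₀ : Fin L} {a b : Fin N → ℤ} {Q : ℤ}

/-- If the head surplus is negative somewhere, the extremal windows of a class of maximal winding are
deficient windows at both ends of the line, saturated in the sense of `saturated_of_cover`. These
two make the tail surplus `-1` along that class, which forces the head surplus to be `-1` on the
whole turn after its first negative place `t₀`, and the tail surplus to be nonpositive near the
other end. -/
lemma exists_flat_turn (E : GenericConfig a b Q P) (D : ModuliData N g P M l₀)
    (hC : ∀ l, CircleMatch a b Q (M l)) (hneg : ∃ t, headSurplus a b Q t < 0) :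
    ∃ t₀, (∀ t, t₀ ≤ t → t ≤ t₀ + Q → headSurplus a b Q t = -1) ∧
      ∀ u, (2 * P - 3) * Q - 2 * t₀ < 2 * u → u < (P - 1) * Q → tailSurplus a b u ≤ 0 := by
  have hQ := E.turn_pos
  have hMP := D.least_lt_top
  have hM0 := D.pos l₀
  obtain ⟨s, hs⟩ := exists_winding_max (a := a) (b := b) hQ
  obtain ⟨-, t₀, -, -, -, hHt₀, ⟨i₀, hi₀⟩, hwt₀, hfirst, -, -⟩ := exists_upper_base E D hC hs hneg
  -- from here on the class of `t₀ - 1`, of maximal winding, replaces that of `s`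
  have hs' : ∀ u, winding a b Q u ≤ winding a b Q (t₀ - 1) := by rwa [hwt₀]
  obtain ⟨s₀, t₀', hs₀c, hs₀Q, hs₀h, hHt₀', -, -, hfirst', hsmall, hdom⟩ :=
    exists_upper_base E D hC hs' hneg
  obtain rfl : t₀' = t₀ := by
    rcases lt_trichotomy t₀ t₀' with h | h | h
    · have := hfirst' _ h; omega
    · exact h.symm
    · have := hfirst _ h; omega
  obtain ⟨s₁, t₁, hs₁c, hs₁P, hs₁h, hHt₁, hle1, hnn1, hlarge, hdom'⟩ :=
    exists_lower_base E D hC hs' hneg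
  obtain ⟨-, ht₁⟩ := E.headSurplus_neg (t := t₁) (by omega)
  have hai₀ := E.a_nonneg i₀
  -- the two bases lie in one class, `P + 1` turns apart
  have hs₁ : s₁ = s₀ + (P + 1) * Q := by
    obtain ⟨c, hc⟩ := dvd_sub hs₁c hs₀c
    have hc' : s₁ - s₀ = Q * c := by rw [← hc]; ring
    have h1 : c ≤ P + 1 := by by_contra! h; nlinarith
    have h2 : (P : ℤ) + 1 ≤ c := by by_contra! h; nlinarith
    have : c = P + 1 := le_antisymm h1 h2
    rw [this] at hc'
    linarith
  set κ := (P + 1) * Q - (t₁ - t₀') with hκ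
  have hκ2 : 5 * Q + 2 * t₀' < 2 * κ := by rw [hκ]; linarith
  have htail_le : ∀ j : ℤ, 1 ≤ j → j * Q < κ → tailSurplus a b (s₀ + j * Q) ≤ -1 := by
    intro j hj hjκ
    have hjQ : 0 < j * Q := by positivity
    rw [← hHt₀]
    rcases le_total (s₀ + j * Q) t₀' with h | h
    · exact hdom _ _ ⟨j, by ring⟩ h (by linarith)
    · exact hdom' _ _ ⟨j - (P + 1), by rw [hs₁]; ring⟩ h (by linarith)
  have hhead_far : ∀ j : ℤ, j * Q < κ → 0 ≤ headSurplus a b Q (t₁ + (j - 1 - P) * Q) := by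
    intro j hj
    apply hfirst
    have : (j - 1 - P) * Q = j * Q - (P + 1) * Q := by ring
    linarith
  have hshift : ∀ j : ℤ, windowSurplus a b Q s₁ t₁ (j - 1 - P)
      = headSurplus a b Q (t₁ + (j - 1 - P) * Q) - tailSurplus a b (s₀ + j * Q) := by
    intro j
    rw [windowSurplus, hs₁]
    congr 2
    ring
  have htail : ∀ j : ℤ, 1 ≤ j → j * Q < κ → tailSurplus a b (s₀ + j * Q) = -1 := by
    intro j hj hjκ
    have h1 := htail_le j hj hjκ
    have h2 := hhead_far j hjκ
    have h3 := hle1 (j - 1 - P)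
    rw [hshift] at h3
    omega
  -- otherwise the lower window would have a positive surplus at `M l₀ - P`, a multiple of `M l₀`
  have hκM : κ ≤ ((M l₀ : ℤ) + 1) * Q := by
    by_contra! hlt
    have h1 := htail_le (M l₀ + 1) (by omega) hlt
    have h2 := hhead_far (M l₀ + 1) hlt
    have h3 := hshift (M l₀ + 1)
    have h4 := (hlarge (M l₀ + 1 - 1 - P) (by omega) (by omega)).1
    apply h4
    rw [show (M l₀ : ℤ) + 1 - 1 - P = M l₀ - P by ring]
    exact dvd_sub_self_left.2 (Int.natCast_dvd_natCast.2 D.least_dvd)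
  -- the head surplus is `-1` on the whole turn after `t₀`
  have hflat : ∀ t, t₀' ≤ t → t ≤ t₀' + Q → headSurplus a b Q t = -1 := by
    have e1 : headSurplus a b Q (t₀' + Q) = -1 := by
      have h1 := hsmall 1 one_ne_zero (by omega) (by rw [abs_one]; omega)
      have h2 := htail 1 le_rfl (by linarith)
      rw [windowSurplus, h2, one_mul] at h1
      omega
    have e2 : tailSurplus a b (t₀' - 1 + Q) = -1 := by
      obtain ⟨c, hc⟩ := hs₀c
      have hc1 : 0 < -c := by by_contra! h; nlinarith
      have := htail (-c + 1) (by omega) (by nlinarith)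
      rwa [show s₀ + (-c + 1) * Q = t₀' - 1 + Q by linarith] at this
    have e3 : countBelow a (t₀' + Q) = countBelow a (t₀' - 1 + Q) := by
      rw [show t₀' + Q = t₀' - 1 + Q + 1 by ring, countBelow_succ,
        show t₀' - 1 + Q = a i₀ + 1 * Q by rw [hi₀]; ring, E.sum_a_eq]
      simp
    have m1 := countBelow_mono a (show t₀' ≤ t₀' - 1 + Q by omega)
    have m2 := countBelow_mono b (show t₀' - 1 + Q ≤ t₀' + Q by omega)
    intro t h1 h2
    have m3 := countBelow_mono a h1
    have m4 := countBelow_mono a h2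
    have m5 := countBelow_mono b (show t₀' + Q ≤ t + Q by omega)
    have m6 := countBelow_mono b (show t + Q ≤ t₀' + Q + Q by omega)
    unfold headSurplus tailSurplus at *
    omega
  refine ⟨t₀', hflat, fun u hu1 hu2 => ?_⟩
  obtain ⟨-, ht₀⟩ := E.headSurplus_neg (t := t₀') (by omega)
  set m := (u - t₁) / Q with hm
  have hd1 := Int.ediv_mul_le (u - t₁) hQ.ne'
  have hd2 := Int.lt_ediv_add_one_mul_self (u - t₁) hQ
  rw [← hm] at hd1 hd2
  have hd3 : (m + 1) * Q = m * Q + Q := by ring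
  rw [hd3] at hd2
  have hle := tailSurplus_le_headSurplus (a := a) (b := b) (Q := Q) (t := t₁ + m * Q)
    (u := u) (by linarith) (by linarith)
  rcases lt_trichotomy m 0 with hneg | hzero | hpos
  · have h3 := hle1 m
    have hmQ : m * Q < 0 := mul_neg_of_neg_of_pos hneg hQ
    have h4 : tailSurplus a b (s₁ + m * Q) ≤ -1 := by
      rw [← hHt₁]
      rcases le_total (s₁ + m * Q) t₁ with h | h
      · exact hdom _ _ ⟨P + 1 + m, by rw [hs₁]; ring⟩ h (by linarith)
      · exact hdom' _ _ ⟨m, by ring⟩ h (by linarith)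
    simp only [windowSurplus] at h3
    omega
  · rw [hzero, zero_mul, add_zero] at hle
    omega
  · have hmM : m < M l₀ := by
      by_contra! hle
      have := mul_le_mul_of_nonneg_right hle hQ.le
      linarith
    have h4 : windowSurplus a b Q s₁ t₁ m ≤ 0 := by
      by_contra! hlt
      have := (hlarge m (by omega) hlt).2
      rw [abs_of_pos hpos] at this
      omega
    have h5 : tailSurplus a b (s₁ + m * Q) = 0 := by
      apply E.tailSurplus_eq_zero_of_ge
      have := mul_pos hpos hQ
      linarith
    simp only [windowSurplus] at h4
    omega

/-- The head surplus is never negative. Otherwise it is negative in every class, in particular in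
one of minimal winding; and there the shortest deficient window violates the cover bound. -/
lemma headSurplus_nonneg (E : GenericConfig a b Q P) (D : ModuliData N g P M l₀)
    (hC : ∀ l, CircleMatch a b Q (M l)) (t : ℤ) : 0 ≤ headSurplus a b Q t := by
  by_contra hcon
  obtain ⟨t₀, hflat, hfar⟩ := exists_flat_turn E D hC ⟨t, by omega⟩
  clear hcon t
  have hQ := E.turn_pos
  have ht₀ := (E.headSurplus_neg (t := t₀) (by have := hflat t₀ le_rfl (by omega); omega)).1
  obtain ⟨t, ht1, ht2, htmin⟩ := exists_winding_min (a := a) (b := b) hQ t₀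
  have hHt := hflat t ht1 ht2.le
  obtain ⟨n, hnt, hn, p, hp⟩ := exists_last_nonneg
    (F := fun n m => windowSurplus a b Q (t - n) t m) (n₀ := t.toNat) (m₀ := 0)
    (fun m => by
      have := tailSurplus_le_headSurplus (a := a) (b := b) (t := t + m * Q) (u := t + m * Q)
        (Q := Q) le_rfl (by omega)
      simp only [windowSurplus, Nat.cast_zero, sub_zero]
      omega)
    (by
      simp only [windowSurplus, zero_mul, add_zero]
      rw [Int.toNat_of_nonneg (by omega), sub_self, hHt, E.tailSurplus_eq_zero_of_nonpos le_rfl]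
      norm_num)
  set t₂ := t + p * Q with ht₂
  have hshift₂ : ∀ (k : ℕ) m, windowSurplus a b Q (t₂ - k) t₂ m
      = windowSurplus a b Q (t - k) t (p + m) := by
    intro k m
    simp only [windowSurplus, ht₂]
    congr 2 <;> ring
  set s₂ := t₂ - (n + 1) with hs₂
  obtain ⟨⟨i, hi⟩, h0, hnn, hw⟩ := E.step_tail_down (s := s₂) (t := t₂)
    (fun m => by rw [show s₂ + 1 = t₂ - n by omega, hshift₂]; exact hn n le_rfl _)
    (by
      have := hshift₂ (n + 1) 0
      push_cast at this hp
      rw [hs₂, this, add_zero]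
      exact hp)
  have hai := E.a_nonneg i
  have hai' := E.a_lt i
  have ewt : winding a b Q t₂ = winding a b Q t := winding_add_mul hQ t p
  have hmin := htmin (s₂ + 1)
  have hbase : headSurplus a b Q t₂ - tailSurplus a b s₂ = -1 := by
    simpa [windowSurplus] using h0
  have hrange : ∀ m, 0 < windowSurplus a b Q s₂ t₂ m → |m| < P := by
    intro m hm
    have : 0 < headSurplus a b Q (t₂ + m * Q) ∨ tailSurplus a b (s₂ + m * Q) < 0 := by
      by_contra! hcon
      simp only [windowSurplus] at hm
      omega
    rcases this with h | h
    · obtain ⟨h1, h2⟩ := E.headSurplus_pos h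
      have hm1 : m < P := by by_contra! hle; nlinarith
      rw [abs_lt]
      refine ⟨?_, hm1⟩
      by_contra! hm2
      -- now `t₂` is beyond all the `a i`, so the tail surplus is positive near the far end
      have ht₂P : (2 * P - 1) * Q < 2 * t₂ := by nlinarith
      have hk : 1 ≤ tailSurplus a b s₂ := by
        by_contra! hlt
        have := (E.headSurplus_neg (t := t₂) (by omega)).2
        linarith
      have := hfar s₂ (by
        have : (n : ℤ) + 1 ≤ t := by omega
        linarith) (by omega)
      omega
    · obtain ⟨h1, h2⟩ := E.tailSurplus_neg h
      rw [abs_lt]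
      constructor <;> by_contra! hle <;> nlinarith
  obtain ⟨c1, -⟩ := windowSurplus_saturated E D hC (s := s₂) (t := t₂) h0 hnn
    (by omega) (e := P) (Or.inl rfl) (fun m hm => Or.inl (hrange m hm))
  have := hrange _ c1
  rw [abs_of_nonneg (by positivity)] at this
  omega

/-- Interchanging the two families, with half a turn of compensation, interchanges head and tail
surplus. -/
lemma tailSurplus_nonpos (E : GenericConfig a b (2 * Q) P) (D : ModuliData N g P M l₀)
    (hC : ∀ l, CircleMatch a b (2 * Q) (M l)) (s : ℤ) : tailSurplus a b s ≤ 0 := by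
  have hQ := E.turn_pos
  have E' : GenericConfig (fun j => b j - Q) (fun i => a i + Q) (2 * Q) P :=
    { turn_pos := hQ
      a_inj := fun j j' h => E.b_inj j j' (by simpa using h)
      b_inj := fun i i' h => E.a_inj i i' (by simpa using h)
      a_b := fun j i h => E.a_b i j (by
        have h' := dvd_add h (dvd_refl (2 * Q))
        rw [show b j - Q - (a i + Q) + 2 * Q = b j - a i by ring] at h'
        exact (dvd_sub_comm).1 h')
      a_nonneg := fun j => by have := E.le_b j; omega
      a_lt := fun j => by have := E.b_lt j; linarith
      le_b := fun i => by have := E.a_nonneg i; omega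
      b_lt := fun i => by have := E.a_lt i; linarith }
  have hC' : ∀ l, CircleMatch (fun j => b j - Q) (fun i => a i + Q) (2 * Q) (M l) := by
    intro l
    obtain ⟨π, hπ⟩ := hC l
    refine ⟨π.symm, fun j => ?_⟩
    obtain ⟨k, hk, h1, h2⟩ := hπ (π.symm j)
    rw [Equiv.apply_symm_apply] at h1 h2
    refine ⟨-k, (dvd_neg).2 hk, ?_, ?_⟩ <;> simp only <;> linarith
  have h := headSurplus_nonneg E' D hC' (s - Q)
  have e1 : countBelow (fun i => a i + Q) (s - Q + 2 * Q) = countBelow a s := by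
    unfold countBelow
    apply Finset.sum_congr rfl
    intro i _
    simp only
    split_ifs <;> omega
  have e2 : countBelow (fun j => b j - Q) (s - Q) = countBelow b s := by
    unfold countBelow
    apply Finset.sum_congr rfl
    intro i _
    simp only
    split_ifs <;> omega
  unfold headSurplus at h
  unfold tailSurplus
  rw [e1, e2] at h
  omega

end Line

lemma succ_le_countBelow {N : ℕ} {x : Fin N → ℤ} (hx : Monotone x) (i : Fin N) {u : ℤ}
    (h : x i < u) : (i : ℤ) + 1 ≤ countBelow x u := by
  have hle : ∑ i' : Fin N, (if i' ≤ i then (1 : ℤ) else 0) ≤ countBelow x u := by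
    apply Finset.sum_le_sum
    intro i' _
    split_ifs with h1 h2 <;> try omega
    exact absurd (lt_of_le_of_lt (hx h1) h) h2
  have : ∑ i' : Fin N, (if i' ≤ i then (1 : ℤ) else 0) = i + 1 := by
    rw [Finset.sum_boole]
    have : (Finset.univ.filter fun i' : Fin N => i' ≤ i) = Finset.Iic i := by ext; simp
    rw [this, Fin.card_Iic]
    push_cast; ring
  omega

lemma countBelow_le_of_le {N : ℕ} {x : Fin N → ℤ} (hx : Monotone x) (i : Fin N) {u : ℤ}
    (h : u ≤ x i) : countBelow x u ≤ i := by
  have hle : countBelow x u ≤ ∑ i' : Fin N, (if i' < i then (1 : ℤ) else 0) := by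
    apply Finset.sum_le_sum
    intro i' _
    split_ifs with h1 h2 <;> try omega
    have := hx (not_lt.1 h2)
    omega
  have : ∑ i' : Fin N, (if i' < i then (1 : ℤ) else 0) = i := by
    rw [Finset.sum_boole]
    have : (Finset.univ.filter fun i' : Fin N => i' < i) = Finset.Iio i := by ext; simp
    rw [this, Fin.card_Iio]
  omega

lemma countBelow_comp_perm {N : ℕ} (x : Fin N → ℤ) (σ : Equiv.Perm (Fin N)) (u : ℤ) :
    countBelow (x ∘ σ) u = countBelow x u :=
  Equiv.sum_comp σ fun i => if x i < u then (1 : ℤ) else 0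

/-- With nonnegative head and nonpositive tail surplus, matching in increasing order puts each `b`
within one turn after its partner. -/
lemma exists_line_match {N P : ℕ} {a b : Fin N → ℤ} {Q : ℤ} (E : GenericConfig a b Q P)
    (hH : ∀ t, 0 ≤ headSurplus a b Q t) (hk : ∀ s, tailSurplus a b s ≤ 0) :
    ∃ σ : Equiv.Perm (Fin N), ∀ i, a i < b (σ i) ∧ b (σ i) < a i + Q := by
  have ha := Tuple.monotone_sort a
  have hb := Tuple.monotone_sort b
  refine ⟨(Tuple.sort a).symm.trans (Tuple.sort b), fun i => ?_⟩
  obtain ⟨r, rfl⟩ := (Tuple.sort a).surjective i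
  simp only [Equiv.trans_apply, Equiv.symm_apply_apply]
  set x := a (Tuple.sort a r) with hx
  set y := b (Tuple.sort b r) with hy
  have hne1 : x ≠ y := fun h => E.a_b _ _ ⟨0, by rw [← hx, ← hy, h]; ring⟩
  have hne2 : y ≠ x + Q := fun h => E.a_b (Tuple.sort a r) (Tuple.sort b r)
    ⟨-1, by rw [← hx, ← hy, h]; ring⟩
  have hxy : x ≤ y := by
    by_contra! hlt
    have h1 := succ_le_countBelow hb r (u := x) hlt
    have h2 := countBelow_le_of_le ha r (u := x) le_rfl
    rw [countBelow_comp_perm] at h1 h2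
    have := hk x
    unfold tailSurplus at this
    omega
  have hyx : y ≤ x + Q := by
    by_contra! hlt
    have h1 := succ_le_countBelow ha r (u := x + 1) (by simp [hx])
    have h2 := countBelow_le_of_le hb r (u := x + 1 + Q) (by simp only [Function.comp]; omega)
    rw [countBelow_comp_perm] at h1 h2
    have := hH (x + 1)
    unfold headSurplus at this
    omega
  omega

/-! ### The moduli of the theorem -/

lemma exists_moduliData {N L g : ℕ} (hN : 0 < N) {M : Fin L → ℕ} (hpos : ∀ l, 0 < M l)
    (hmono : StrictMono M) (hco : ∀ l l', l ≠ l' → Nat.Coprime (M l) (M l'))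
    (hg : 1 ≤ g) (hceil : ⌈(L : ℝ) / (N : ℝ)⌉₊ = g + 1) :
    ∃ l₀, ModuliData N g (headProd N M) M l₀ := by
  have hcard : g * N + 1 ≤ L := by
    have h : g < ⌈(L : ℝ) / (N : ℝ)⌉₊ := by omega
    rw [Nat.lt_ceil, lt_div_iff₀ (by exact_mod_cast hN)] at h
    exact_mod_cast h
  have hL : 2 ≤ L := by
    have : 1 * 1 ≤ g * N := Nat.mul_le_mul hg hN
    omega
  have hP : headProd N M
      = ∏ l ∈ Finset.univ.filter (fun l : Fin L => (l : ℕ) < g + 1), M l := by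
    rw [headProd, hceil]
  set l₀ : Fin L := ⟨0, by omega⟩ with hl₀
  set l₁ : Fin L := ⟨1, by omega⟩ with hl₁
  have h01 : M l₀ < M l₁ := hmono (by simp [hl₀, hl₁, Fin.lt_def])
  have hpos0 := hpos l₀
  refine ⟨l₀, hpos, hg, hcard, ?_, ?_, ?_, ?_, ?_⟩
  · intro m hm hmP
    by_contra! hlt
    have h1 := prod_initial_le hpos hmono (g + 1) (modDivisors M m) hlt
    have h2 := prod_le_natAbs_of_dvd hco hm (modDivisors M m) fun l hl => mem_modDivisors.1 hl
    rw [← hP] at h1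
    rw [Int.abs_eq_natAbs] at hmP
    omega
  · refine le_trans (Finset.card_le_card fun l hl => ?_) (filter_lt_card_le (L := L) (g + 1))
    rw [mem_modDivisors, Int.natCast_dvd_natCast, hP] at hl
    rw [Finset.mem_filter]
    refine ⟨Finset.mem_univ _, ?_⟩
    by_contra! hge
    -- a later modulus is coprime to the product, and exceeds `1`
    have hcop : Nat.Coprime (M l)
        (∏ l ∈ Finset.univ.filter (fun l : Fin L => (l : ℕ) < g + 1), M l) := by
      apply Nat.Coprime.prod_right
      intro l' hl'
      apply hco
      rintro rfl
      have := (Finset.mem_filter.1 hl').2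
      omega
    have h1 := Nat.Coprime.eq_one_of_dvd hcop hl
    have h2 : M l₀ < M l := hmono (by rw [Fin.lt_def, hl₀]; simp only; omega)
    omega
  · rw [hP]
    exact Finset.dvd_prod_of_mem _ (by simp [hl₀])
  · rw [hP]
    have hne : l₀ ≠ l₁ := by simp [hl₀, hl₁]
    calc M l₀ < M l₀ * M l₁ := by nlinarith
      _ = ∏ l ∈ {l₀, l₁}, M l := (Finset.prod_pair hne).symm
      _ ≤ _ := by
        apply Finset.prod_le_prod_of_subset_of_one_le'
        · intro l hl
          simp only [Finset.mem_insert, Finset.mem_singleton] at hl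
          rcases hl with rfl | rfl
          · simp [hl₀]
          · simp [hl₁]
            omega
        · exact fun l _ _ => hpos l
  · intro l hl
    apply hmono
    rw [Fin.lt_def, hl₀]
    have : (l : ℕ) ≠ 0 := fun h => hl (Fin.ext h)
    simp only
    omega

/-! ### From real to integer positions -/

/-- Rounding real positions to a grid of `2 N K` points per unit, where `K = 2 K'`, with the residue
modulo `2 N` used to keep all classes apart. -/
lemma genericConfig_of_real {N P K' : ℕ} (hN : 0 < N) (hK : 0 < K') {x y : Fin N → ℝ}
    (hx : ∀ i, 0 ≤ x i ∧ x i < (P : ℝ) - 1) (hy : ∀ i, 0 ≤ y i ∧ y i < (P : ℝ) - 1) :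
    GenericConfig (fun i : Fin N => 2 * N * ⌊(2 * K' : ℝ) * x i⌋ + i)
      (fun j : Fin N => 2 * N * ⌊(2 * K' : ℝ) * y j⌋ + 2 * N * K' + N + j)
      (2 * (2 * N * K')) P := by
  have hN' : (0 : ℤ) < N := by exact_mod_cast hN
  have hK' : (0 : ℤ) < K' := by exact_mod_cast hK
  have hKr : (0 : ℝ) < 2 * K' := by positivity
  have nonneg : ∀ z : ℝ, 0 ≤ z → 0 ≤ ⌊(2 * K' : ℝ) * z⌋ := fun z hz =>
    Int.floor_nonneg.2 (by positivity)
  have upper : ∀ z : ℝ, z < (P : ℝ) - 1 → ⌊(2 * K' : ℝ) * z⌋ + 1 ≤ 2 * K' * ((P : ℤ) - 1) := by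
    intro z hz
    rw [Int.add_one_le_iff, Int.floor_lt]
    push_cast
    exact mul_lt_mul_of_pos_left hz hKr
  have upper' : ∀ z : ℝ, z < (P : ℝ) - 1 →
      2 * N * ⌊(2 * K' : ℝ) * z⌋ + 2 * N ≤ (P - 1) * (2 * (2 * N * K')) := by
    intro z hz
    have := mul_le_mul_of_nonneg_left (upper z hz) (show (0 : ℤ) ≤ 2 * N by omega)
    calc (2 * N * ⌊(2 * K' : ℝ) * z⌋ + 2 * N : ℤ)
        = 2 * N * (⌊(2 * K' : ℝ) * z⌋ + 1) := by ring
      _ ≤ _ := this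
      _ = _ := by ring
  have inj : ∀ i i' : Fin N, ∀ c : ℤ, (i : ℤ) - i' = 2 * N * c → i = i' := by
    intro i i' c h
    have h1 := i.isLt
    have h2 := i'.isLt
    have : c = 0 := by
      have h3 : c < 1 := by by_contra! h; nlinarith
      have h4 : -1 < c := by by_contra! h; nlinarith
      omega
    rw [this, mul_zero] at h
    exact Fin.ext (by omega)
  refine ⟨by positivity, ?_, ?_, ?_, ?_, ?_, ?_, ?_⟩
  · rintro i i' ⟨c, hc⟩
    apply inj i i' (2 * K' * c - ⌊(2 * K' : ℝ) * x i⌋ + ⌊(2 * K' : ℝ) * x i'⌋)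
    linear_combination hc
  · rintro j j' ⟨c, hc⟩
    apply inj j j' (2 * K' * c - ⌊(2 * K' : ℝ) * y j⌋ + ⌊(2 * K' : ℝ) * y j'⌋)
    linear_combination hc
  · rintro i j ⟨c, hc⟩
    have h1 := i.isLt
    have h2 := j.isLt
    have key : (N : ℤ) + j - i
        = 2 * N * (-(2 * K' * c) + ⌊(2 * K' : ℝ) * x i⌋ - ⌊(2 * K' : ℝ) * y j⌋ - K') := by
      linear_combination -hc
    generalize -(2 * K' * c) + ⌊(2 * K' : ℝ) * x i⌋ - ⌊(2 * K' : ℝ) * y j⌋ - (K' : ℤ) = d at key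
    have h3 : d < 1 := by by_contra! h; nlinarith
    have h4 : 0 < d := by by_contra! h; nlinarith
    omega
  · intro i
    have := nonneg _ (hx i).1
    positivity
  · intro i
    have := upper' _ (hx i).2
    have := i.isLt
    linarith
  · intro j
    have := mul_nonneg (show (0 : ℤ) ≤ 2 * N by omega) (nonneg _ (hy j).1)
    have : (0 : ℤ) ≤ j := by positivity
    linarith
  · intro j
    have := upper' _ (hy j).2
    have := j.isLt
    linarith

/-- Two real families in `[0, P - 1)` that can be matched within `1 / 2` modulo each of the moduli
can be matched within `1 / 2`. -/
lemma exists_matching_of_modular {N L : ℕ} (hN : 0 < N) {M : Fin L → ℕ} (hpos : ∀ l, 0 < M l)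
    (hmono : StrictMono M) (hco : ∀ l l', l ≠ l' → Nat.Coprime (M l) (M l'))
    {x y : Fin N → ℝ} (hx : ∀ i, 0 ≤ x i ∧ x i < (headProd N M : ℝ) - 1)
    (hy : ∀ i, 0 ≤ y i ∧ y i < (headProd N M : ℝ) - 1)
    (hmod : ∀ l, ∃ π : Equiv.Perm (Fin N), ∀ i, ∃ k : ℤ, (M l : ℤ) ∣ k ∧
      |x i - y (π i) - k| < 1 / 2) :
    ∃ σ : Equiv.Perm (Fin N), ∀ i, |x i - y (σ i)| ≤ 1 / 2 := by
  have hL : 0 < L := by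
    rcases Nat.eq_zero_or_pos L with rfl | h
    · have := hx ⟨0, hN⟩
      simp [headProd] at this
      linarith
    · exact h
  have hceil0 : 0 < ⌈(L : ℝ) / (N : ℝ)⌉₊ := by
    rw [Nat.ceil_pos]
    positivity
  obtain ⟨g, hg⟩ : ∃ g, ⌈(L : ℝ) / (N : ℝ)⌉₊ = g + 1 := ⟨_, (Nat.succ_pred_eq_of_pos hceil0).symm⟩
  rcases Nat.eq_zero_or_pos g with rfl | hg1
  · -- a single modulus, which is not even wrapped around
    set l₀ : Fin L := ⟨0, hL⟩ with hl₀
    have hP : headProd N M = M l₀ := by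
      rw [headProd, hg]
      have : (Finset.univ.filter fun l : Fin L => (l : ℕ) < 0 + 1) = {l₀} := by
        ext l
        simp [hl₀, Fin.ext_iff]
      rw [this, Finset.prod_singleton]
    obtain ⟨π, hπ⟩ := hmod l₀
    refine ⟨π, fun i => ?_⟩
    obtain ⟨k, hk, hlt⟩ := hπ i
    have hk0 : k = 0 := by
      apply Int.eq_zero_of_abs_lt_dvd hk
      have h1 := hx i
      have h2 := hy (π i)
      rw [hP] at h1 h2
      rw [abs_lt] at hlt
      have : |(k : ℝ)| < M l₀ := by
        rw [abs_lt]
        constructor <;> linarith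
      exact_mod_cast this
    rw [hk0] at hlt
    simpa using hlt.le
  obtain ⟨l₀, D⟩ := exists_moduliData hN hpos hmono hco hg1 hg
  by_contra! hcon
  choose w hw using hcon
  choose π k hk hlt using hmod
  obtain ⟨σ₀, hσ₀⟩ := Finite.exists_min fun σ : Equiv.Perm (Fin N) =>
    |x (w σ) - y (σ (w σ))| - 1 / 2
  set ε := |x (w σ₀) - y (σ₀ (w σ₀))| - 1 / 2 with hε
  have hε0 : 0 < ε := sub_pos.2 (hw σ₀)
  obtain ⟨B, hB⟩ := (Set.finite_range fun p : Fin L × Fin N =>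
    1 / (1 / 2 - |x p.2 - y (π p.1 p.2) - k p.1 p.2|)).bddAbove
  obtain ⟨K', hK'⟩ := exists_nat_gt (max B (1 / ε))
  have hK'ε : 1 / ε < K' := (le_max_right _ _).trans_lt hK'
  have hK'B : B < K' := (le_max_left _ _).trans_lt hK'
  have hK'r : (0 : ℝ) < K' := (by positivity : (0 : ℝ) < 1 / ε).trans hK'ε
  have hK'0 : 0 < K' := by exact_mod_cast hK'r
  have hNz : (0 : ℤ) < N := by exact_mod_cast hN
  have E := genericConfig_of_real hN hK'0 hx hy
  have hC : ∀ l, CircleMatch (fun i : Fin N => 2 * N * ⌊(2 * K' : ℝ) * x i⌋ + i)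
      (fun j : Fin N => 2 * N * ⌊(2 * K' : ℝ) * y j⌋ + 2 * N * K' + N + j)
      (2 * (2 * N * K')) (M l) := by
    intro l
    refine ⟨π l, fun i => ⟨k l i, hk l i, ?_⟩⟩
    have hmargin : 1 ≤ K' * (1 / 2 - |x i - y (π l i) - k l i|) := by
      have hp : 0 < 1 / 2 - |x i - y (π l i) - k l i| := sub_pos.2 (hlt l i)
      have h1 : 1 / (1 / 2 - |x i - y (π l i) - k l i|) ≤ B := hB ⟨(l, i), rfl⟩
      have h2 := h1.trans hK'B.le
      rwa [div_le_iff₀ hp] at h2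
    have habs := hlt l i
    have hle1 := le_abs_self (x i - y (π l i) - k l i)
    have hle2 := neg_abs_le (x i - y (π l i) - k l i)
    generalize |x i - y (π l i) - k l i| = d at *
    have f1 := Int.floor_le ((2 * K' : ℝ) * x i)
    have f2 := Int.lt_floor_add_one ((2 * K' : ℝ) * x i)
    have f3 := Int.floor_le ((2 * K' : ℝ) * y (π l i))
    have f4 := Int.lt_floor_add_one ((2 * K' : ℝ) * y (π l i))
    have hi := i.isLt
    have hj := (π l i).isLt
    set z : ℤ := ⌊(2 * K' : ℝ) * y (π l i)⌋ - ⌊(2 * K' : ℝ) * x i⌋ + K' + 2 * K' * k l i with hz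
    have hz0 : 0 ≤ z := by
      have : (-1 : ℝ) < z := by
        rw [hz]; push_cast
        have : 0 ≤ (K' : ℝ) * (d - (x i - y (π l i) - k l i)) := by
          apply mul_nonneg hK'r.le; linarith
        nlinarith
      exact_mod_cast (by exact_mod_cast this : (-1 : ℤ) < z)
    have hz1 : z + 1 ≤ 2 * K' := by
      have : (z : ℝ) < 2 * K' := by
        rw [hz]; push_cast
        have : 0 ≤ (K' : ℝ) * (d + (x i - y (π l i) - k l i)) := by
          apply mul_nonneg hK'r.le; linarith
        nlinarith
      have : z < 2 * K' := by exact_mod_cast this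
      omega
    have hval : 2 * N * ⌊(2 * K' : ℝ) * y (π l i)⌋ + 2 * N * K' + N + (π l i : ℕ)
        - (2 * N * ⌊(2 * K' : ℝ) * x i⌋ + i) + k l i * (2 * (2 * N * K'))
        = 2 * N * z + (N + (π l i : ℕ) - i) := by
      rw [hz]; ring
    simp only
    rw [hval]
    have hz2 := mul_le_mul_of_nonneg_left hz1 (show (0 : ℤ) ≤ 2 * N by omega)
    have hz3 := mul_nonneg (show (0 : ℤ) ≤ 2 * N by omega) hz0
    constructor
    · omega
    · have e1 : (2 * N : ℤ) * (z + 1) = 2 * N * z + 2 * N := by ring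
      have e2 : (2 * N : ℤ) * (2 * K') = 2 * (2 * N * K') := by ring
      rw [e1, e2] at hz2
      omega
  obtain ⟨σ, hσ⟩ := exists_line_match E (headSurplus_nonneg E D hC) (tailSurplus_nonpos E D hC)
  have hσε : 1 / 2 + ε ≤ |x (w σ) - y (σ (w σ))| := by
    have := hσ₀ σ
    linarith
  obtain ⟨h1, h2⟩ := hσ (w σ)
  set i := w σ
  have f1 := Int.floor_le ((2 * K' : ℝ) * x i)
  have f2 := Int.lt_floor_add_one ((2 * K' : ℝ) * x i)
  have f3 := Int.floor_le ((2 * K' : ℝ) * y (σ i))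
  have f4 := Int.lt_floor_add_one ((2 * K' : ℝ) * y (σ i))
  have hi := i.isLt
  have hj := (σ i).isLt
  set z : ℤ := ⌊(2 * K' : ℝ) * y (σ i)⌋ - ⌊(2 * K' : ℝ) * x i⌋ + K' with hz
  have hval : 2 * N * ⌊(2 * K' : ℝ) * y (σ i)⌋ + 2 * N * K' + N + (σ i : ℕ)
      = 2 * N * ⌊(2 * K' : ℝ) * x i⌋ + i + (2 * N * z + (N + (σ i : ℕ) - i)) := by
    rw [hz]; ring
  rw [hval] at h1 h2
  have hz0 : 0 ≤ z := by
    by_contra! hneg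
    have := mul_le_mul_of_nonneg_left (show z ≤ -1 by omega) (show (0 : ℤ) ≤ 2 * N by omega)
    omega
  have hz1 : z + 1 ≤ 2 * K' := by
    by_contra! hlt
    have h3 := mul_le_mul_of_nonneg_left (show 2 * (K' : ℤ) ≤ z by omega)
      (show (0 : ℤ) ≤ 2 * N by omega)
    have e2 : (2 * N : ℤ) * (2 * K') = 2 * (2 * N * K') := by ring
    rw [e2] at h3
    omega
  have hz0' : (0 : ℝ) ≤ z := by exact_mod_cast hz0
  have hz1' : (z : ℝ) + 1 ≤ 2 * K' := by exact_mod_cast hz1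
  have hz' : (z : ℝ) = ⌊(2 * K' : ℝ) * y (σ i)⌋ - ⌊(2 * K' : ℝ) * x i⌋ + K' := by
    rw [hz]; push_cast; ring
  have hKε : 1 < K' * ε := by rwa [div_lt_iff₀ hε0] at hK'ε
  have hfin : |x i - y (σ i)| < 1 / 2 + ε := by
    rw [abs_lt]
    constructor
    · by_contra! hle
      have := mul_le_mul_of_nonneg_left hle hK'r.le
      linarith
    · by_contra! hle
      have := mul_le_mul_of_nonneg_left hle hK'r.le
      linarith
  linarith

/-! ### Observations, hypotheses and the decoder -/

lemma exists_perm_of_map_univ_eq {ι α : Type*} [Fintype ι] {f g : ι → α}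
    (h : (Finset.univ : Finset ι).val.map f = (Finset.univ : Finset ι).val.map g) :
    ∃ π : Equiv.Perm ι, ∀ i, g (π i) = f i := by
  classical
  have e : ∀ c, Nonempty ({i // f i = c} ≃ {i // g i = c}) := by
    intro c
    have hc := congrArg (Multiset.count c) h
    rw [Multiset.count_map, Multiset.count_map] at hc
    rw [← Fintype.card_eq, Fintype.card_subtype, Fintype.card_subtype]
    simp only [Finset.card_def, Finset.filter_val]
    simpa only [eq_comm] using hc
  exact ⟨Equiv.ofFiberEquiv fun c => (e c).some, fun i => Equiv.ofFiberEquiv_map _ i⟩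

lemma exists_sub_eq_of_realMod_eq {x y m : ℝ} (h : realMod x m = realMod y m) :
    ∃ c : ℤ, x - y = m * c := by
  refine ⟨⌊x / m⌋ - ⌊y / m⌋, ?_⟩
  unfold realMod at h
  push_cast
  linarith

/-- Admissible pairs `(Y, Δ)` of unknowns and errors which explain the observation `R`. -/
def Explains {N L : ℕ} (Γ : ℝ) (M : Fin L → ℕ) (R : Fin L → Multiset ℝ)
    (p : (Fin N → ℝ) × (Fin N → Fin L → ℝ)) : Prop :=
  (∀ i, 0 ≤ p.1 i ∧ p.1 i < Γ * ((headProd N M : ℝ) - 1)) ∧ (∀ i l, |p.2 i l| < Γ / 4) ∧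
    noisyResidues Γ M p.1 p.2 = R

open Classical in
/-- The decoder: choose some admissible explanation of the observation, and return the averages of
its unfolded noisy readings. -/
noncomputable def explainingDecoder {N L : ℕ} (Γ : ℝ) (M : Fin L → ℕ) (R : Fin L → Multiset ℝ) :
    Fin N → ℝ :=
  if h : ∃ p : (Fin N → ℝ) × (Fin N → Fin L → ℝ), Explains Γ M R p then
    fun i => (∑ l, (h.choose.1 i + h.choose.2 i l)) / (L : ℝ)
  else 0

/-- The folding number of `y`: adding `Γ / 4` before rounding down makes every reading
of `y` with error less than `Γ / 4` lie between `-Γ / 2` and `Γ` from its `Γ`-multiple. -/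
noncomputable def foldingNumber (Γ y : ℝ) : ℤ := ⌊y / Γ + 1 / 4⌋

open Classical in
/-- The hypothesis which clusters the noisy readings correctly, and shifts exactly
those common residues whose reading lies below the folding number of the unknown. -/
noncomputable def correctHypothesis {N L : ℕ} (Γ : ℝ) (M : Fin L → ℕ) (Y : Fin N → ℝ)
    (Δ : Fin N → Fin L → ℝ) : Hypothesis N L where
  cluster i l := realMod (Y i + Δ i l) (Γ * (M l : ℝ))
  shift i l := if Y i + Δ i l < foldingNumber Γ (Y i) * Γ then 1 else 0

lemma foldingNumber_mul_le {Γ : ℝ} (hΓ : 0 < Γ) (y : ℝ) :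
    foldingNumber Γ y * Γ ≤ y + Γ / 4 := by
  have h := Int.floor_le (y / Γ + 1 / 4)
  have h' := mul_le_mul_of_nonneg_right h hΓ.le
  have : (y / Γ + 1 / 4) * Γ = y + Γ / 4 := by field_simp
  rw [this] at h'
  exact h'

lemma lt_foldingNumber_mul {Γ : ℝ} (hΓ : 0 < Γ) (y : ℝ) :
    y + Γ / 4 < (foldingNumber Γ y + 1) * Γ := by
  have h := Int.lt_floor_add_one (y / Γ + 1 / 4)
  have h' := mul_lt_mul_of_pos_right h hΓ
  have : (y / Γ + 1 / 4) * Γ = y + Γ / 4 := by field_simp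
  rw [this] at h'
  exact h'

lemma floor_realMod_div {Γ z : ℝ} (hΓ : 0 < Γ) {m : ℕ} :
    ⌊realMod z (Γ * m) / Γ⌋ = ⌊z / Γ⌋ - m * ⌊z / (Γ * m)⌋ := by
  have : realMod z (Γ * m) / Γ = z / Γ - ((m * ⌊z / (Γ * m)⌋ : ℤ) : ℝ) := by
    unfold realMod
    push_cast
    field_simp
  rw [this, Int.floor_sub_intCast]

/-- The shifted common residue of a reading is its offset from the unknown's `Γ`-multiple. -/
lemma correctHypothesis_commonResidue {N L : ℕ} {Γ : ℝ} (hΓ : 0 < Γ) (M : Fin L → ℕ)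
    {Y : Fin N → ℝ} {Δ : Fin N → Fin L → ℝ} {i : Fin N} {l : Fin L} (hΔ : |Δ i l| < Γ / 4) :
    (correctHypothesis Γ M Y Δ).commonResidue Γ i l
      = Y i + Δ i l - foldingNumber Γ (Y i) * Γ := by
  obtain ⟨h1, h2⟩ := abs_lt.1 hΔ
  have h3 := foldingNumber_mul_le hΓ (Y i)
  have h4 := lt_foldingNumber_mul hΓ (Y i)
  have hfl := floor_realMod_div (z := Y i + Δ i l) hΓ (m := M l)
  have hc : (correctHypothesis Γ M Y Δ).cluster i l
    = realMod (Y i + Δ i l) (Γ * (M l : ℝ)) := rfl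
  rw [Hypothesis.commonResidue, hc]
  by_cases hs : Y i + Δ i l < foldingNumber Γ (Y i) * Γ
  · have hshift : (correctHypothesis Γ M Y Δ).shift i l = 1 := if_pos hs
    have hf : ⌊(Y i + Δ i l) / Γ⌋ = foldingNumber Γ (Y i) - 1 := by
      rw [Int.floor_eq_iff, le_div_iff₀ hΓ, div_lt_iff₀ hΓ]
      push_cast
      constructor <;> linarith
    rw [hf] at hfl
    rw [hshift, realMod, hfl, realMod]
    push_cast
    simp
    ring
  · have hshift : (correctHypothesis Γ M Y Δ).shift i l = 0 := if_neg hs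
    have hf : ⌊(Y i + Δ i l) / Γ⌋ = foldingNumber Γ (Y i) := by
      rw [Int.floor_eq_iff, le_div_iff₀ hΓ, div_lt_iff₀ hΓ]
      constructor <;> linarith
    rw [hf] at hfl
    rw [hshift, realMod, hfl, realMod]
    push_cast
    simp
    ring

lemma foldingNumber_nonneg {Γ y : ℝ} (hΓ : 0 < Γ) (hy : 0 ≤ y) : 0 ≤ foldingNumber Γ y :=
  Int.floor_nonneg.2 (by positivity)

lemma correctHypothesis_accepted {N L : ℕ} {Γ : ℝ} (hΓ : 0 < Γ) {M : Fin L → ℕ}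
    {Y : Fin N → ℝ} (hY : ∀ i, 0 ≤ Y i ∧ Y i < Γ * ((headProd N M : ℝ) - 1))
    {Δ : Fin N → Fin L → ℝ} (hΔ : ∀ i l, |Δ i l| < Γ / 4) :
    (correctHypothesis Γ M Y Δ).Accepted Γ M (noisyResidues Γ M Y Δ)
      fun i => (foldingNumber Γ (Y i)).toNat where
  isClustering _ := rfl
  folding i l := by
    refine ⟨foldingNumber Γ (Y i) - M l * ⌊(Y i + Δ i l) / (Γ * M l)⌋, ?_, ?_⟩
    · rw [correctHypothesis_commonResidue hΓ M (hΔ i l)]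
      simp only [correctHypothesis, realMod]
      push_cast
      ring
    · rw [Int.toNat_of_nonneg (foldingNumber_nonneg hΓ (hY i).1)]
      exact (Int.modEq_iff_dvd.2 ⟨-⌊(Y i + Δ i l) / (Γ * M l)⌋, by ring⟩)
  criterion_one i l l' := by
    rw [correctHypothesis_commonResidue hΓ M (hΔ i l),
      correctHypothesis_commonResidue hΓ M (hΔ i l')]
    have h1 := abs_lt.1 (hΔ i l)
    have h2 := abs_lt.1 (hΔ i l')
    rw [abs_lt]
    constructor <;> linarith
  criterion_two i := by
    have h := foldingNumber_mul_le hΓ (Y i)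
    have h0 := foldingNumber_nonneg hΓ (hY i).1
    have hlt : (foldingNumber Γ (Y i) : ℝ) < headProd N M := by
      have := (hY i).2
      have : (foldingNumber Γ (Y i) : ℝ) * Γ < headProd N M * Γ := by linarith
      exact lt_of_mul_lt_mul_right this hΓ.le
    have : foldingNumber Γ (Y i) < headProd N M := by exact_mod_cast hlt
    omega

lemma correctHypothesis_estimate {N L : ℕ} {Γ : ℝ} (hΓ : 0 < Γ) (hL : 0 < L) {M : Fin L → ℕ}
    {Y : Fin N → ℝ} (hY : ∀ i, 0 ≤ Y i)
    {Δ : Fin N → Fin L → ℝ} (hΔ : ∀ i l, |Δ i l| < Γ / 4) :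
    (correctHypothesis Γ M Y Δ).estimate Γ (fun i => (foldingNumber Γ (Y i)).toNat)
      = fun i => (∑ l, (Y i + Δ i l)) / (L : ℝ) := by
  funext i
  have hL' : (L : ℝ) ≠ 0 := by positivity
  have h0 : (((foldingNumber Γ (Y i)).toNat : ℕ) : ℝ) = foldingNumber Γ (Y i) := by
    exact_mod_cast Int.toNat_of_nonneg (foldingNumber_nonneg hΓ (hY i))
  rw [Hypothesis.estimate, h0]
  simp only [correctHypothesis_commonResidue hΓ M (hΔ i _)]
  rw [Finset.sum_sub_distrib, Finset.sum_const, Finset.card_univ, Fintype.card_fin, nsmul_eq_mul]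
  field_simp
  ring

lemma abs_average_sub_lt {L : ℕ} (hL : 0 < L) {y c : ℝ} {δ : Fin L → ℝ} (hδ : ∀ l, |δ l| < c) :
    |(∑ l, (y + δ l)) / (L : ℝ) - y| < c := by
  have hL' : (0 : ℝ) < L := by exact_mod_cast hL
  have hsum : (∑ l, (y + δ l)) / (L : ℝ) - y = (∑ l, δ l) / L := by
    rw [Finset.sum_add_distrib, Finset.sum_const, Finset.card_univ, Fintype.card_fin, nsmul_eq_mul]
    field_simp
    ring
  have : Nonempty (Fin L) := ⟨⟨0, hL⟩⟩
  rw [hsum, abs_div, abs_of_pos hL', div_lt_iff₀ hL']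
  calc |∑ l, δ l| ≤ ∑ l, |δ l| := Finset.abs_sum_le_sum_abs _ _
    _ < ∑ _l : Fin L, c := Finset.sum_lt_sum_of_nonempty Finset.univ_nonempty fun l _ => hδ l
    _ = c * L := by simp [mul_comm]

/-- Two admissible explanations of one observation agree within `Γ / 2`, up to order. -/
lemma exists_perm_abs_sub_le {N L : ℕ} (hN : 0 < N) {Γ : ℝ} (hΓ : 0 < Γ) {M : Fin L → ℕ}
    (hpos : ∀ l, 0 < M l) (hmono : StrictMono M)
    (hco : ∀ l l', l ≠ l' → Nat.Coprime (M l) (M l')) {R : Fin L → Multiset ℝ}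
    {p p' : (Fin N → ℝ) × (Fin N → Fin L → ℝ)} (hp : Explains Γ M R p)
    (hp' : Explains Γ M R p') :
    ∃ σ : Equiv.Perm (Fin N), ∀ i, |p.1 i - p'.1 (σ i)| ≤ Γ / 2 := by
  have range : ∀ {q : (Fin N → ℝ) × (Fin N → Fin L → ℝ)}, Explains Γ M R q →
      ∀ i, 0 ≤ q.1 i / Γ ∧ q.1 i / Γ < (headProd N M : ℝ) - 1 := fun hq i =>
    ⟨div_nonneg (hq.1 i).1 hΓ.le, by rw [div_lt_iff₀ hΓ, mul_comm]; exact (hq.1 i).2⟩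
  obtain ⟨σ, hσ⟩ := exists_matching_of_modular hN hpos hmono hco
    (x := fun i => p.1 i / Γ) (y := fun i => p'.1 i / Γ) (range hp) (range hp') (by
    intro l
    obtain ⟨π, hπ⟩ := exists_perm_of_map_univ_eq (congrFun (hp.2.2.trans hp'.2.2.symm) l)
    refine ⟨π, fun i => ?_⟩
    obtain ⟨c, hc⟩ := exists_sub_eq_of_realMod_eq (hπ i).symm
    refine ⟨M l * c, dvd_mul_right _ _, ?_⟩
    have h1 := abs_lt.1 (hp.2.1 i l)
    have h2 := abs_lt.1 (hp'.2.1 (π i) l)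
    have : p.1 i / Γ - p'.1 (π i) / Γ - ((M l * c : ℤ) : ℝ)
        = (p'.2 (π i) l - p.2 i l) / Γ := by
      push_cast
      field_simp
      linarith
    rw [this, abs_div, abs_of_pos hΓ, div_lt_iff₀ hΓ, abs_lt]
    constructor <;> linarith)
  refine ⟨σ, fun i => ?_⟩
  have h := hσ i
  rw [← sub_div, abs_div, abs_of_pos hΓ, div_le_iff₀ hΓ] at h
  linarith

theorem theorem4 (N L : ℕ) (hN : 0 < N) (Γ : ℝ) (hΓ : 0 < Γ) (M : Fin L → ℕ)
    (hM_pos : ∀ l, 0 < M l) (hM_mono : StrictMono M)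
    (hM_coprime : ∀ l l', l ≠ l' → Nat.Coprime (M l) (M l')) :
    ∃ decode : (Fin L → Multiset ℝ) → (Fin N → ℝ),
      ∀ X : Fin N → ℝ, (∀ i, 0 ≤ X i ∧ X i < Γ * ((headProd N M : ℝ) - 1)) →
      ∀ Δ : Fin N → Fin L → ℝ, (∀ i l, |Δ i l| < Γ / 4) →
        (∃ (h : Hypothesis N L) (q : Fin N → ℕ),
          h.Accepted Γ M (noisyResidues Γ M X Δ) q ∧
          decode (noisyResidues Γ M X Δ) = h.estimate Γ q) ∧
        ∃ σ : Equiv.Perm (Fin N),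
          ∀ i, |decode (noisyResidues Γ M X Δ) (σ i) - X i| < 3 * Γ / 4 := by
  refine ⟨explainingDecoder Γ M, fun X hX Δ hΔ => ?_⟩
  -- without moduli the range of `X` would be empty
  have hL : 0 < L := by
    rcases Nat.eq_zero_or_pos L with rfl | h
    · have := hX ⟨0, hN⟩
      simp [headProd] at this
      linarith
    · exact h
  have htrue : Explains Γ M (noisyResidues Γ M X Δ) (X, Δ) := ⟨hX, hΔ, rfl⟩
  have hex : ∃ p : (Fin N → ℝ) × (Fin N → Fin L → ℝ), Explains Γ M (noisyResidues Γ M X Δ) p :=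
    ⟨_, htrue⟩
  have hdec : explainingDecoder Γ M (noisyResidues Γ M X Δ)
      = fun i => (∑ l, (hex.choose.1 i + hex.choose.2 i l)) / (L : ℝ) := dif_pos hex
  have hp := hex.choose_spec
  rw [hdec]
  generalize hex.choose = p at hp
  obtain ⟨hY, hD, hR⟩ := hp
  refine ⟨⟨correctHypothesis Γ M p.1 p.2, _, hR ▸ correctHypothesis_accepted hΓ hY hD,
    (correctHypothesis_estimate hΓ hL (fun i => (hY i).1) hD).symm⟩, ?_⟩
  obtain ⟨σ, hσ⟩ := exists_perm_abs_sub_le hN hΓ hM_pos hM_mono hM_coprime htrue ⟨hY, hD, hR⟩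
  refine ⟨σ, fun i => ?_⟩
  have h1 := abs_lt.1 (abs_average_sub_lt hL (y := p.1 (σ i)) (hD (σ i)))
  have h2 := abs_le.1 (hσ i)
  simp only at h2 ⊢
  rw [abs_lt]
  constructor <;> linarith
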